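/- Let $\mathbb{K}$ be a field of characteristic zero, $X$ a topological space and $\mathcal{O}_X$ a sheaf of commutative $\mathbb{K}$-algebras on $X$; for example, $(X,\mathcal{O}_X)$ may be a smooth manifold, a complex manifold, an analytic space or an algebraic variety with its structure sheaf. Let $\mathcal{L}$ be a Lie algebroid over $(X,\mathcal{O}_X)$, that is, a sheaf of $(\mathbb{K},\mathcal{O}_X)$-Lie–Rinehart algebras: $\mathcal{L}$ is a sheaf of $\mathbb{K}$-Lie algebras and of $\mathcal{O}_X$-modules with an $\mathcal{O}_X$-linear anchor $\mathfrak{a}\colon\mathcal{L}\to\mathcal{D}er_{\mathbb{K}}(\mathcal{O}_X)$ that is a morphism of sheaves of Lie algebras and satisfies $[D,fD']=f[D,D']+\mathfrak{a}(D)(f)D'$. Assume that $\mathcal{L}$ is locally free: every point has an open neighbourhood $U$ with $\mathcal{L}|_U\cong\mathcal{O}_X^{\oplus I}|_U$ for some set $I$, possibly infinite. For an open set $U$ let $\mathcal{U}(\mathcal{O}_X(U),\mathcal{L}(U))$ be the universal enveloping algebra of the Lie–Rinehart algebra $\mathcal{L}(U)$, that is, the unital associative $\mathbb{K}$-algebra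 generated by the algebra $\mathcal{O}_X(U)$ and by symbols $\bar D$ ($D\in\mathcal{L}(U)$), additive in $D$, subject to $\overline{fD}=f\bar D$, $\overline{[D,D']}=\bar D\bar D'-\bar D'\bar D$ and $\bar D f-f\bar D=\mathfrak{a}(D)(f)$; let $\mathcal{U}_{(n)}(\mathcal{O}_X(U),\mathcal{L}(U))$ be its left $\mathcal{O}_X(U)$-submodule spanned by the products $\bar D_1\cdots\bar D_m$ with $0\le m\le n$. Let $\mathscr{U}(\mathcal{O}_X,\mathcal{L})$ be the sheafification of $U\mapsto\mathcal{U}(\mathcal{O}_X(U),\mathcal{L}(U))$, filtered by the sheafifications $\mathscr{U}_{(n)}(\mathcal{O}_X,\mathcal{L})$ of $U\mapsto\mathcal{U}_{(n)}(\mathcal{O}_X(U),\mathcal{L}(U))$, and let $$gr(\mathscr{U}(\mathcal{O}_X,\mathcal{L}))=\bigoplus_{n\ge0}\mathscr{U}_{(n)}(\mathcal{O}_X,\mathcal{L})/\mathscr{U}_{(n-1)}(\mathcal{O}_X,\mathcal{L}),\qquad \mathscr{U}_{(-1)}=0,$$ be the associated sheaf of graded algebras, quotients and direct sum being taken in sheaves.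 Let $\mathcal{S}_{\mathcal{O}_X}\mathcal{L}$ be the sheafification of the presheaf of symmetric algebras $U\mapsto S_{\mathcal{O}_X(U)}\mathcal{L}(U)$. Then there is an isomorphism of sheaves of $\mathcal{O}_X$-algebras $$\theta\colon\mathcal{S}_{\mathcal{O}_X}\mathcal{L}\xrightarrow{\ \sim\ }gr(\mathscr{U}(\mathcal{O}_X,\mathcal{L}))$$ that sends each section $D$ of $\mathcal{L}$ to the class of $\bar D$ in degree $1$. -/

import Mathlib

open CategoryTheory TopologicalSpace Opposite
open scoped DirectSum

universe u

noncomputable section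

/-! ### Filtered rings and associated graded rings -/

/-- An increasing filtration `F 0 ⊆ F 1 ⊆ ⋯` of a ring by additive subgroups,
with `1 ∈ F 0` and `F m * F n ⊆ F (m + n)`. -/
structure RingFiltration (A : Type u) [Ring A] where
  F : ℕ → AddSubgroup A
  mono : Monotone F
  one_mem : (1 : A) ∈ F 0
  mul_mem : ∀ {m n : ℕ} {a b : A}, a ∈ F m → b ∈ F n → a * b ∈ F (m + n)

namespace RingFiltration

variable {A B C : Type u} [Ring A] [Ring B] [Ring C]

/-- The previous step of the filtration, `F (n - 1)`, with the convention `F (-1) = 0`. -/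
def below (Φ : RingFiltration A) : ℕ → AddSubgroup A
  | 0 => ⊥
  | n + 1 => Φ.F n

theorem below_mul_mem (Φ : RingFiltration A) {m n : ℕ} {a b : A} (ha : a ∈ Φ.below m)
    (hb : b ∈ Φ.F n) : a * b ∈ Φ.below (m + n) := by
  cases m with
  | zero =>
    have h0 : a = 0 := ha
    rw [h0, zero_mul]; exact zero_mem _
  | succ m =>
    have h : a * b ∈ Φ.F (m + n) := Φ.mul_mem ha hb
    rw [Nat.succ_add]; exact h

theorem mul_below_mem (Φ : RingFiltration A) {m n : ℕ} {a b : A} (ha : a ∈ Φ.F m)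
    (hb : b ∈ Φ.below n) : a * b ∈ Φ.below (m + n) := by
  cases n with
  | zero =>
    have h0 : b = 0 := hb
    rw [h0, mul_zero]; exact zero_mem _
  | succ n =>
    have h : a * b ∈ Φ.F (m + n) := Φ.mul_mem ha hb
    exact h

/-- The `n`-th graded piece `F n / F (n - 1)`. -/
abbrev Piece (Φ : RingFiltration A) (n : ℕ) : Type u :=
  Φ.F n ⧸ (Φ.below n).addSubgroupOf (Φ.F n)

/-- The class in `F n / F (n - 1)` of an element of `F n`. -/
def piece (Φ : RingFiltration A) (n : ℕ) (a : A) (ha : a ∈ Φ.F n) : Φ.Piece n :=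
  QuotientAddGroup.mk ⟨a, ha⟩

theorem piece_eq_iff (Φ : RingFiltration A) {n : ℕ} {a b : A} (ha : a ∈ Φ.F n) (hb : b ∈ Φ.F n) :
    Φ.piece n a ha = Φ.piece n b hb ↔ -a + b ∈ Φ.below n := by
  unfold piece
  rw [QuotientAddGroup.eq, AddSubgroup.mem_addSubgroupOf]
  rfl

theorem exists_piece (Φ : RingFiltration A) {n : ℕ} (x : Φ.Piece n) :
    ∃ a ha, x = Φ.piece n a ha := by
  obtain ⟨⟨a, ha⟩, rfl⟩ := QuotientAddGroup.mk_surjective x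
  exact ⟨a, ha, rfl⟩

/-- The product `F m / F (m - 1) × F n / F (n - 1) → F (m + n) / F (m + n - 1)` induced by the
multiplication of the ring. -/
def pieceMul (Φ : RingFiltration A) {m n : ℕ} (x : Φ.Piece m) (y : Φ.Piece n) : Φ.Piece (m + n) :=
  Quotient.map₂ (fun (a : Φ.F m) (b : Φ.F n) => (⟨a.1 * b.1, Φ.mul_mem a.2 b.2⟩ : Φ.F (m + n)))
    (by
      intro a a' haa b b' hbb
      have h1 : -a.1 + a'.1 ∈ Φ.below m := by
        have := QuotientAddGroup.leftRel_apply.1 haa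
        rwa [AddSubgroup.mem_addSubgroupOf] at this
      have h2 : -b.1 + b'.1 ∈ Φ.below n := by
        have := QuotientAddGroup.leftRel_apply.1 hbb
        rwa [AddSubgroup.mem_addSubgroupOf] at this
      refine QuotientAddGroup.leftRel_apply.2 ?_
      rw [AddSubgroup.mem_addSubgroupOf]
      have h3 : -(a.1 * b.1) + a'.1 * b'.1 = (-a.1 + a'.1) * b.1 + a'.1 * (-b.1 + b'.1) := by
        noncomm_ring
      change -(a.1 * b.1) + a'.1 * b'.1 ∈ _
      rw [h3]
      exact add_mem (Φ.below_mul_mem h1 b.2) (Φ.mul_below_mem a'.2 h2)) x y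

theorem pieceMul_piece (Φ : RingFiltration A) {m n : ℕ} {a b : A} (ha : a ∈ Φ.F m)
    (hb : b ∈ Φ.F n) :
    Φ.pieceMul (Φ.piece m a ha) (Φ.piece n b hb) = Φ.piece (m + n) (a * b) (Φ.mul_mem ha hb) :=
  rfl

theorem piece_add (Φ : RingFiltration A) {n : ℕ} {a b : A} (ha : a ∈ Φ.F n) (hb : b ∈ Φ.F n) :
    Φ.piece n a ha + Φ.piece n b hb = Φ.piece n (a + b) (add_mem ha hb) :=
  rfl

theorem piece_congr (Φ : RingFiltration A) {m n : ℕ} (h : m = n) {a b : A} (hab : a = b)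
    (ha : a ∈ Φ.F m) (hb : b ∈ Φ.F n) :
    (GradedMonoid.mk m (Φ.piece m a ha) : GradedMonoid Φ.Piece) =
      GradedMonoid.mk n (Φ.piece n b hb) := by
  subst h; subst hab; rfl

instance (Φ : RingFiltration A) : GradedMonoid.GMul Φ.Piece where
  mul := Φ.pieceMul

instance (Φ : RingFiltration A) : GradedMonoid.GOne Φ.Piece where
  one := Φ.piece 0 1 Φ.one_mem

instance (Φ : RingFiltration A) : DirectSum.GRing Φ.Piece where
  mul_zero := by
    intro i j x
    obtain ⟨a, ha, rfl⟩ := Φ.exists_piece x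
    change Φ.pieceMul (Φ.piece i a ha) (Φ.piece j 0 (zero_mem _)) = Φ.piece (i + j) 0 (zero_mem _)
    rw [pieceMul_piece]
    simp only [mul_zero]
  zero_mul := by
    intro i j x
    obtain ⟨a, ha, rfl⟩ := Φ.exists_piece x
    change Φ.pieceMul (Φ.piece i 0 (zero_mem _)) (Φ.piece j a ha) = Φ.piece (i + j) 0 (zero_mem _)
    rw [pieceMul_piece]
    simp only [zero_mul]
  mul_add := by
    intro i j x y z
    obtain ⟨a, ha, rfl⟩ := Φ.exists_piece x
    obtain ⟨b, hb, rfl⟩ := Φ.exists_piece y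
    obtain ⟨c, hc, rfl⟩ := Φ.exists_piece z
    change Φ.pieceMul _ _ = Φ.pieceMul _ _ + Φ.pieceMul _ _
    simp only [piece_add, pieceMul_piece, mul_add]
  add_mul := by
    intro i j x y z
    obtain ⟨a, ha, rfl⟩ := Φ.exists_piece x
    obtain ⟨b, hb, rfl⟩ := Φ.exists_piece y
    obtain ⟨c, hc, rfl⟩ := Φ.exists_piece z
    change Φ.pieceMul _ _ = Φ.pieceMul _ _ + Φ.pieceMul _ _
    simp only [piece_add, pieceMul_piece, add_mul]
  one_mul := by
    rintro ⟨i, x⟩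
    obtain ⟨a, ha, rfl⟩ := Φ.exists_piece x
    exact Φ.piece_congr (zero_add i) (one_mul a) _ _
  mul_one := by
    rintro ⟨i, x⟩
    obtain ⟨a, ha, rfl⟩ := Φ.exists_piece x
    exact Φ.piece_congr (add_zero i) (mul_one a) _ _
  mul_assoc := by
    rintro ⟨i, x⟩ ⟨j, y⟩ ⟨k, z⟩
    obtain ⟨a, ha, rfl⟩ := Φ.exists_piece x
    obtain ⟨b, hb, rfl⟩ := Φ.exists_piece y
    obtain ⟨c, hc, rfl⟩ := Φ.exists_piece z
    exact Φ.piece_congr (add_assoc i j k) (mul_assoc a b c) _ _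
  natCast n := n • Φ.piece 0 1 Φ.one_mem
  natCast_zero := zero_nsmul _
  natCast_succ n := succ_nsmul _ n
  intCast n := n • Φ.piece 0 1 Φ.one_mem
  intCast_ofNat n := natCast_zsmul _ n
  intCast_negSucc_ofNat n := negSucc_zsmul _ n

/-- The associated graded ring `⨁ n, F n / F (n - 1)`. -/
abbrev Gr (Φ : RingFiltration A) : Type u := ⨁ n, Φ.Piece n

/-- The symbol of degree `n` of an element of `F n`: its class in `F n / F (n - 1)`, as an element
of the associated graded ring. -/
def symbol (Φ : RingFiltration A) (n : ℕ) (a : A) (ha : a ∈ Φ.F n) : Φ.Gr :=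
  DirectSum.of Φ.Piece n (Φ.piece n a ha)

theorem symbol_mul (Φ : RingFiltration A) {m n : ℕ} {a b : A} (ha : a ∈ Φ.F m)
    (hb : b ∈ Φ.F n) :
    Φ.symbol m a ha * Φ.symbol n b hb = Φ.symbol (m + n) (a * b) (Φ.mul_mem ha hb) := by
  unfold symbol
  rw [DirectSum.of_mul_of]
  rfl

/-- A ring homomorphism is filtered if it maps each `F n` into `F n`. -/
def IsFiltered (Φ : RingFiltration A) (Ψ : RingFiltration B) (f : A →+* B) : Prop :=
  ∀ n a, a ∈ Φ.F n → f a ∈ Ψ.F n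

theorem IsFiltered.below {Φ : RingFiltration A} {Ψ : RingFiltration B} {f : A →+* B}
    (hf : Φ.IsFiltered Ψ f) {n : ℕ} {a : A} (ha : a ∈ Φ.below n) : f a ∈ Ψ.below n := by
  cases n with
  | zero =>
    have h0 : a = 0 := ha
    rw [h0, map_zero]; exact zero_mem _
  | succ n => exact hf n a ha

/-- The map `F n / F (n - 1) → F n / F (n - 1)` induced by a filtered ring homomorphism. -/
def pieceMap {Φ : RingFiltration A} {Ψ : RingFiltration B} {f : A →+* B}
    (hf : Φ.IsFiltered Ψ f) (n : ℕ) : Φ.Piece n →+ Ψ.Piece n :=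
  QuotientAddGroup.map _ _
    ({ toFun := fun a => ⟨f a.1, hf n a.1 a.2⟩
       map_zero' := Subtype.ext (map_zero f)
       map_add' := fun a b => Subtype.ext (map_add f a.1 b.1) } : Φ.F n →+ Ψ.F n)
    (fun a ha => hf.below (a := a.1) ha)

theorem pieceMap_piece {Φ : RingFiltration A} {Ψ : RingFiltration B} {f : A →+* B}
    (hf : Φ.IsFiltered Ψ f) {n : ℕ} {a : A} (ha : a ∈ Φ.F n) :
    pieceMap hf n (Φ.piece n a ha) = Ψ.piece n (f a) (hf n a ha) :=
  rfl

/-- The ring homomorphism of associated graded rings induced by a filtered ring homomorphism. -/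
def grMap {Φ : RingFiltration A} {Ψ : RingFiltration B} {f : A →+* B}
    (hf : Φ.IsFiltered Ψ f) : Φ.Gr →+* Ψ.Gr :=
  DirectSum.toSemiring (fun n => (DirectSum.of Ψ.Piece n).comp (pieceMap hf n))
    (by
      have h : ∀ h1 : f 1 ∈ Ψ.F 0, Ψ.piece 0 (f 1) h1 = Ψ.piece 0 1 Ψ.one_mem := by
        rw [map_one]; intro _; rfl
      change DirectSum.of Ψ.Piece 0 (Ψ.piece 0 (f 1) (hf 0 1 Φ.one_mem)) = 1
      rw [h]
      rfl)
    (by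
      intro i j x y
      obtain ⟨a, ha, rfl⟩ := Φ.exists_piece x
      obtain ⟨b, hb, rfl⟩ := Φ.exists_piece y
      change Ψ.symbol (i + j) (f (a * b)) _ = Ψ.symbol i (f a) _ * Ψ.symbol j (f b) _
      rw [symbol_mul]
      simp only [map_mul])

theorem grMap_symbol {Φ : RingFiltration A} {Ψ : RingFiltration B} {f : A →+* B}
    (hf : Φ.IsFiltered Ψ f) {n : ℕ} {a : A} (ha : a ∈ Φ.F n) :
    grMap hf (Φ.symbol n a ha) = Ψ.symbol n (f a) (hf n a ha) := by
  unfold grMap symbol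
  rw [DirectSum.toSemiring_of]
  rfl

theorem gr_hom_ext {Φ : RingFiltration A} {R : Type u} [Ring R] {f g : Φ.Gr →+* R}
    (h : ∀ n a ha, f (Φ.symbol n a ha) = g (Φ.symbol n a ha)) : f = g := by
  apply DirectSum.ringHom_ext
  intro i x
  obtain ⟨a, ha, rfl⟩ := Φ.exists_piece x
  exact h i a ha

end RingFiltration

/-! ### The universal enveloping algebra of a Lie–Rinehart algebra -/

section Enveloping

variable (K A L : Type u) [CommRing K] [CommRing A] [Algebra K A] [LieRing L] [Module A L]
  [LieRingModule L A]

/-- The defining relations of the universal enveloping algebra: `A → 𝒰(A, L)` is a homomorphism of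
unital `K`-algebras, `L → 𝒰(A, L)` is additive and a homomorphism of Lie algebras, and, for `a : A`
and `x : L`, one has `a · x = a • x` and `x · a - a · x = x(a)`, where `x(a) = ⁅x, a⁆` is the action
of `x` on `a` by the anchor. -/
inductive EnvelopingRel : FreeAlgebra K (A ⊕ L) → FreeAlgebra K (A ⊕ L) → Prop
  | algebraMap (k : K) : EnvelopingRel (FreeAlgebra.ι K (Sum.inl (algebraMap K A k)))
      (algebraMap K (FreeAlgebra K (A ⊕ L)) k)
  | add (a b : A) : EnvelopingRel (FreeAlgebra.ι K (Sum.inl (a + b)))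
      (FreeAlgebra.ι K (Sum.inl a) + FreeAlgebra.ι K (Sum.inl b))
  | mul (a b : A) : EnvelopingRel (FreeAlgebra.ι K (Sum.inl (a * b)))
      (FreeAlgebra.ι K (Sum.inl a) * FreeAlgebra.ι K (Sum.inl b))
  | add_lie (x y : L) : EnvelopingRel (FreeAlgebra.ι K (Sum.inr (x + y)))
      (FreeAlgebra.ι K (Sum.inr x) + FreeAlgebra.ι K (Sum.inr y))
  | smul_lie (a : A) (x : L) : EnvelopingRel (FreeAlgebra.ι K (Sum.inr (a • x)))
      (FreeAlgebra.ι K (Sum.inl a) * FreeAlgebra.ι K (Sum.inr x))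
  | lie (x y : L) : EnvelopingRel (FreeAlgebra.ι K (Sum.inr x) * FreeAlgebra.ι K (Sum.inr y))
      (FreeAlgebra.ι K (Sum.inr y) * FreeAlgebra.ι K (Sum.inr x) +
        FreeAlgebra.ι K (Sum.inr ⁅x, y⁆))
  | anchor (x : L) (a : A) : EnvelopingRel
      (FreeAlgebra.ι K (Sum.inr x) * FreeAlgebra.ι K (Sum.inl a))
      (FreeAlgebra.ι K (Sum.inl a) * FreeAlgebra.ι K (Sum.inr x) + FreeAlgebra.ι K (Sum.inl ⁅x, a⁆))

/-- The universal enveloping algebra `𝒰(A, L)` of a `(K, A)`-Lie–Rinehart algebra `L`. -/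
def EnvelopingAlgebra : Type u := RingQuot (EnvelopingRel K A L)

instance : Ring (EnvelopingAlgebra K A L) :=
  inferInstanceAs (Ring (RingQuot (EnvelopingRel K A L)))

instance : Algebra K (EnvelopingAlgebra K A L) :=
  inferInstanceAs (Algebra K (RingQuot (EnvelopingRel K A L)))

namespace EnvelopingAlgebra

/-- The quotient map from the free algebra on `A ⊕ L` to `𝒰(A, L)`. -/
def mk : FreeAlgebra K (A ⊕ L) →ₐ[K] EnvelopingAlgebra K A L :=
  RingQuot.mkAlgHom K (EnvelopingRel K A L)

variable {K A L} in
theorem mk_rel {p q : FreeAlgebra K (A ⊕ L)} (h : EnvelopingRel K A L p q) :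
    mk K A L p = mk K A L q :=
  RingQuot.mkAlgHom_rel K h

/-- The canonical homomorphism `A → 𝒰(A, L)` of `K`-algebras. -/
def ιA : A →ₐ[K] EnvelopingAlgebra K A L :=
  AlgHom.ofLinearMap
    { toFun := fun a => mk K A L (FreeAlgebra.ι K (Sum.inl a))
      map_add' := fun a b => by
        simpa using mk_rel (EnvelopingRel.add (K := K) (L := L) a b)
      map_smul' := fun k a => by
        have h1 := mk_rel
          (EnvelopingRel.mul (K := K) (L := L) (algebraMap K A k) a)
        have h2 := mk_rel (EnvelopingRel.algebraMap (A := A) (L := L) k)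
        rw [map_mul, h2, AlgHom.commutes, ← Algebra.smul_def, ← Algebra.smul_def] at h1
        exact h1 }
    (by
      have h2 := mk_rel (EnvelopingRel.algebraMap (A := A) (L := L) (1 : K))
      rw [map_one, map_one, map_one] at h2
      exact h2)
    (fun a b => by
      have h1 := mk_rel (EnvelopingRel.mul (K := K) (L := L) a b)
      rw [map_mul] at h1
      exact h1)

/-- The canonical map `L → 𝒰(A, L)`. -/
def ιL : L →+ EnvelopingAlgebra K A L :=
  AddMonoidHom.mk' (fun x => mk K A L (FreeAlgebra.ι K (Sum.inr x))) (fun x y => by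
    simpa using mk_rel (EnvelopingRel.add_lie (K := K) (A := A) x y))

theorem ιL_smul (a : A) (x : L) : ιL K A L (a • x) = ιA K A L a * ιL K A L x := by
  have h := mk_rel (EnvelopingRel.smul_lie (K := K) a x)
  rw [map_mul] at h
  exact h

theorem ιL_lie (x y : L) :
    ιL K A L ⁅x, y⁆ = ιL K A L x * ιL K A L y - ιL K A L y * ιL K A L x := by
  have h := mk_rel (EnvelopingRel.lie (K := K) (A := A) x y)
  rw [map_add, map_mul, map_mul] at h
  exact eq_sub_of_add_eq' h.symm

theorem ιA_lie (x : L) (a : A) :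
    ιA K A L ⁅x, a⁆ = ιL K A L x * ιA K A L a - ιA K A L a * ιL K A L x := by
  have h := mk_rel (EnvelopingRel.anchor (K := K) x a)
  rw [map_add, map_mul, map_mul] at h
  exact eq_sub_of_add_eq' h.symm

variable {K A L}

/-- The universal property of `𝒰(A, L)`. -/
def lift {B : Type u} [Ring B] [Algebra K B] (φ : A →ₐ[K] B) (ψ : L →+ B)
    (hsmul : ∀ a x, ψ (a • x) = φ a * ψ x)
    (hlie : ∀ x y, ψ ⁅x, y⁆ = ψ x * ψ y - ψ y * ψ x)
    (hanchor : ∀ (x : L) (a : A), φ ⁅x, a⁆ = ψ x * φ a - φ a * ψ x) :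
    EnvelopingAlgebra K A L →ₐ[K] B :=
  RingQuot.liftAlgHom K ⟨FreeAlgebra.lift K (Sum.elim φ ψ), by
    intro p q h
    cases h <;> simp [*]⟩

section lift

variable {B : Type u} [Ring B] [Algebra K B] (φ : A →ₐ[K] B) (ψ : L →+ B)
    (hsmul : ∀ a x, ψ (a • x) = φ a * ψ x)
    (hlie : ∀ x y, ψ ⁅x, y⁆ = ψ x * ψ y - ψ y * ψ x)
    (hanchor : ∀ (x : L) (a : A), φ ⁅x, a⁆ = ψ x * φ a - φ a * ψ x)

theorem lift_ιA (a : A) : lift φ ψ hsmul hlie hanchor (ιA K A L a) = φ a := by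
  refine (RingQuot.liftAlgHom_mkAlgHom_apply K _ _ _).trans ?_
  rw [FreeAlgebra.lift_ι_apply]
  rfl

theorem lift_ιL (x : L) : lift φ ψ hsmul hlie hanchor (ιL K A L x) = ψ x := by
  refine (RingQuot.liftAlgHom_mkAlgHom_apply K _ _ _).trans ?_
  rw [FreeAlgebra.lift_ι_apply]
  rfl

end lift

theorem hom_ext {B : Type u} [Ring B] [Algebra K B] {f g : EnvelopingAlgebra K A L →ₐ[K] B}
    (hA : ∀ a, f (ιA K A L a) = g (ιA K A L a)) (hL : ∀ x, f (ιL K A L x) = g (ιL K A L x)) :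
    f = g := by
  apply RingQuot.ringQuot_ext'
  apply FreeAlgebra.hom_ext
  funext s
  cases s with
  | inl a => exact hA a
  | inr x => exact hL x

variable (K A L) in
/-- The `n`-th step of the canonical filtration of `𝒰(A, L)`: the left `A`-submodule spanned by `A`
and the products of at most `n` elements of `L`. -/
def filtrationStep (n : ℕ) : AddSubgroup (EnvelopingAlgebra K A L) :=
  AddSubgroup.closure
    {u | ∃ (a : A) (l : List L), l.length ≤ n ∧ u = ιA K A L a * (l.map (ιL K A L)).prod}

theorem filtrationStep_mono : Monotone (filtrationStep K A L) := by
  intro m n hmn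
  apply AddSubgroup.closure_mono
  rintro u ⟨a, l, hl, rfl⟩
  exact ⟨a, l, hl.trans hmn, rfl⟩

theorem ιA_mem (a : A) : ιA K A L a ∈ filtrationStep K A L 0 :=
  AddSubgroup.subset_closure ⟨a, [], le_rfl, by simp⟩

theorem ιL_mem (x : L) : ιL K A L x ∈ filtrationStep K A L 1 :=
  AddSubgroup.subset_closure ⟨1, [x], le_rfl, by simp⟩

theorem ιA_mul_mem (a : A) {n : ℕ} {u : EnvelopingAlgebra K A L}
    (hu : u ∈ filtrationStep K A L n) : ιA K A L a * u ∈ filtrationStep K A L n := by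
  induction hu using AddSubgroup.closure_induction with
  | mem u hu =>
    obtain ⟨b, l, hl, rfl⟩ := hu
    exact AddSubgroup.subset_closure ⟨a * b, l, hl, by rw [map_mul, mul_assoc]⟩
  | zero => rw [mul_zero]; exact zero_mem _
  | add u v _ _ hu hv => rw [mul_add]; exact add_mem hu hv
  | neg u _ hu => rw [mul_neg]; exact neg_mem hu

theorem ιL_mul_mem (x : L) {n : ℕ} {u : EnvelopingAlgebra K A L}
    (hu : u ∈ filtrationStep K A L n) : ιL K A L x * u ∈ filtrationStep K A L (n + 1) := by
  induction hu using AddSubgroup.closure_induction with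
  | mem u hu =>
    obtain ⟨b, l, hl, rfl⟩ := hu
    have h : ιL K A L x * (ιA K A L b * (l.map (ιL K A L)).prod) =
        ιA K A L b * ((x :: l).map (ιL K A L)).prod +
          ιA K A L ⁅x, b⁆ * (l.map (ιL K A L)).prod := by
      rw [ιA_lie, List.map_cons, List.prod_cons]
      noncomm_ring
    rw [h]
    exact add_mem (AddSubgroup.subset_closure ⟨b, x :: l, by simpa using hl, rfl⟩)
      (AddSubgroup.subset_closure ⟨⁅x, b⁆, l, hl.trans (Nat.le_succ n), rfl⟩)
  | zero => rw [mul_zero]; exact zero_mem _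
  | add u v _ _ hu hv => rw [mul_add]; exact add_mem hu hv
  | neg u _ hu => rw [mul_neg]; exact neg_mem hu

theorem prod_mul_mem (l : List L) {n : ℕ} {u : EnvelopingAlgebra K A L}
    (hu : u ∈ filtrationStep K A L n) :
    (l.map (ιL K A L)).prod * u ∈ filtrationStep K A L (l.length + n) := by
  induction l with
  | nil => simpa using hu
  | cons x l ih =>
    rw [List.map_cons, List.prod_cons, mul_assoc, List.length_cons, Nat.succ_add]
    exact ιL_mul_mem x ih

theorem filtrationStep_mul_mem {m n : ℕ} {u v : EnvelopingAlgebra K A L}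
    (hu : u ∈ filtrationStep K A L m) (hv : v ∈ filtrationStep K A L n) :
    u * v ∈ filtrationStep K A L (m + n) := by
  induction hu using AddSubgroup.closure_induction with
  | mem u hu =>
    obtain ⟨b, l, hl, rfl⟩ := hu
    rw [mul_assoc]
    exact filtrationStep_mono (Nat.add_le_add_right hl n) (ιA_mul_mem b (prod_mul_mem l hv))
  | zero => rw [zero_mul]; exact zero_mem _
  | add u w _ _ hu hw => rw [add_mul]; exact add_mem hu hw
  | neg u _ hu => rw [neg_mul]; exact neg_mem hu

end EnvelopingAlgebra

end Enveloping

namespace EnvelopingAlgebra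

section map

variable {K A L A' L' : Type u} [CommRing K] [CommRing A] [Algebra K A] [LieRing L]
  [LieAlgebra K L] [Module A L] [LieRingModule L A] [CommRing A'] [Algebra K A'] [LieRing L']
  [LieAlgebra K L'] [Module A' L'] [LieRingModule L' A'] {σ : A →ₐ[K] A'}

/-- The homomorphism `𝒰(A, L) → 𝒰(A', L')` induced by a morphism of Lie–Rinehart algebras, given by
`a x₁ ⋯ xₙ ↦ σ(a) f(x₁) ⋯ f(xₙ)`. -/
def map (f : LieRinehartAlgebra.Hom σ L L') :
    EnvelopingAlgebra K A L →ₐ[K] EnvelopingAlgebra K A' L' :=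
  lift ((ιA K A' L').comp σ) ((ιL K A' L').comp (f.toLieHom : L →ₗ[K] L').toAddMonoidHom)
    (fun a x => by
      have h := f.map_smul_apply a x
      change ιL K A' L' (f (a • x)) = _
      rw [h, ιL_smul]; rfl)
    (fun x y => by
      have h := LieHom.map_lie f.toLieHom x y
      change ιL K A' L' (f ⁅x, y⁆) = _
      rw [h, ιL_lie]; rfl)
    (fun x a => by
      have h := f.apply_lie a x
      change ιA K A' L' (σ ⁅x, a⁆) = _
      rw [h, ιA_lie]; rfl)

theorem map_ιA (f : LieRinehartAlgebra.Hom σ L L') (a : A) :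
    map f (ιA K A L a) = ιA K A' L' (σ a) :=
  lift_ιA ..

theorem map_ιL (f : LieRinehartAlgebra.Hom σ L L') (x : L) :
    map f (ιL K A L x) = ιL K A' L' (f x) :=
  lift_ιL ..

theorem map_mem (f : LieRinehartAlgebra.Hom σ L L') {n : ℕ} {u : EnvelopingAlgebra K A L}
    (hu : u ∈ filtrationStep K A L n) : map f u ∈ filtrationStep K A' L' n := by
  induction hu using AddSubgroup.closure_induction with
  | mem u hu =>
    obtain ⟨b, l, hl, rfl⟩ := hu
    refine AddSubgroup.subset_closure ⟨σ b, l.map f, by simpa using hl, ?_⟩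
    rw [_root_.map_mul, map_ιA, map_list_prod, List.map_map, List.map_map]
    congr 3
    funext x
    exact map_ιL f x
  | zero => rw [_root_.map_zero]; exact zero_mem _
  | add u w _ _ hu hw => rw [_root_.map_add]; exact add_mem hu hw
  | neg u _ hu => rw [_root_.map_neg]; exact neg_mem hu

end map

end EnvelopingAlgebra

/-! ### Lie algebroids -/

/-- A Lie algebroid over a space `X` with a sheaf `O` of commutative `K`-algebras, that is, a sheaf
of `(K, O)`-Lie–Rinehart algebras: every `L(U)` is a `(K, O(U))`-Lie–Rinehart algebra (the anchor is
the action `⁅D, f⁆ ∈ O(U)` of `D ∈ L(U)` on `f ∈ O(U)`), the restriction maps are compatible with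
all of the structure, and compatible families of sections glue uniquely. -/
structure LieAlgebroid {K : Type u} [Field K] {X : TopCat.{u}}
    (O : TopCat.Sheaf (CommAlgCat.{u} K) X) where
  obj : (Opens X)ᵒᵖ → Type u
  [lieRing : ∀ U, LieRing (obj U)]
  [lieAlgebra : ∀ U, LieAlgebra K (obj U)]
  [module : ∀ U, Module (O.presheaf.obj U) (obj U)]
  [lieRingModule : ∀ U, LieRingModule (obj U) (O.presheaf.obj U)]
  [lieRinehartRing : ∀ U, LieRinehartRing (O.presheaf.obj U) (obj U)]
  [lieRinehartAlgebra : ∀ U, LieRinehartAlgebra K (O.presheaf.obj U) (obj U)]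
  res : ∀ {U V : (Opens X)ᵒᵖ} (i : U ⟶ V),
    LieRinehartAlgebra.Hom (O.presheaf.map i).hom (obj U) (obj V)
  res_id : ∀ (U : (Opens X)ᵒᵖ) (s : obj U), res (𝟙 U) s = s
  res_comp : ∀ {U V W : (Opens X)ᵒᵖ} (i : U ⟶ V) (j : V ⟶ W) (s : obj U),
    res (i ≫ j) s = res j (res i s)
  existsUnique_gluing : ∀ {ι : Type u} (U : ι → Opens X) (s : ∀ i, obj (op (U i))),
    (∀ i j, res (Opens.infLELeft (U i) (U j)).op (s i) =
      res (Opens.infLERight (U i) (U j)).op (s j)) →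
    ∃! t : obj (op (iSup U)), ∀ i, res (Opens.leSupr U i).op t = s i

attribute [instance] LieAlgebroid.lieRing LieAlgebroid.lieAlgebra LieAlgebroid.module
  LieAlgebroid.lieRingModule LieAlgebroid.lieRinehartRing LieAlgebroid.lieRinehartAlgebra

namespace LieAlgebroid

variable {K : Type u} [Field K] {X : TopCat.{u}} {O : TopCat.Sheaf (CommAlgCat.{u} K) X}
  (L : LieAlgebroid O)

/-- `L` is locally free if every point has an open neighbourhood `U` with `L|_U ≅ O^{⊕I}|_U` for
some set `I`, possibly infinite. Such an isomorphism is the same as a family `e` of sections of `L`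
over `U` (the images of the standard sections) for which the induced morphism from the sheaf
`O^{⊕I}|_U`, the sheafification of `V ↦ O(V)^{⊕I}`, to `L|_U` is an isomorphism: on each
`V ⊆ U` the `e i` are linearly independent over `O(V)`, and every section of `L` over `V` is
locally an `O`-linear combination of the `e i`. -/
def IsLocallyFree : Prop :=
  ∀ x : X, ∃ (U : Opens X) (_ : x ∈ U) (I : Type u) (e : I → L.obj (op U)),
    ∀ (V : Opens X) (i : V ⟶ U),
      LinearIndependent (O.presheaf.obj (op V)) (fun k => L.res i.op (e k)) ∧
      ∀ (s : L.obj (op V)), ∀ y ∈ V, ∃ (W : Opens X) (_ : y ∈ W) (j : W ⟶ V),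
        L.res j.op s ∈ Submodule.span (O.presheaf.obj (op W))
          (Set.range fun k => L.res (j ≫ i).op (e k))

/-! ### The sheaf of symmetric algebras -/

/-- The restriction map `S(L(U)) → S(L(V))`. -/
def symMap {U V : (Opens X)ᵒᵖ} (i : U ⟶ V) :
    SymmetricAlgebra (O.presheaf.obj U) (L.obj U) →+*
      SymmetricAlgebra (O.presheaf.obj V) (L.obj V) :=
  letI : Algebra (O.presheaf.obj U) (SymmetricAlgebra (O.presheaf.obj V) (L.obj V)) :=
    ((algebraMap (O.presheaf.obj V) (SymmetricAlgebra (O.presheaf.obj V) (L.obj V))).comp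
      (O.presheaf.map i).hom.toRingHom).toAlgebra
  (SymmetricAlgebra.lift
    ({ toFun := fun s => SymmetricAlgebra.ι (O.presheaf.obj V) (L.obj V) (L.res i s)
       map_add' := fun s t => by
        rw [← _root_.map_add]; congr 1; exact map_add (L.res i).toLieHom s t
       map_smul' := fun a s => by
        rw [(L.res i).map_smul_apply, _root_.map_smul, Algebra.smul_def, Algebra.smul_def]
        rfl } : L.obj U →ₗ[O.presheaf.obj U]
          SymmetricAlgebra (O.presheaf.obj V) (L.obj V))).toRingHom

theorem symMap_algebraMap {U V : (Opens X)ᵒᵖ} (i : U ⟶ V) (a : O.presheaf.obj U) :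
    L.symMap i (algebraMap _ _ a) = algebraMap _ _ ((O.presheaf.map i).hom a) := by
  let _ : Algebra (O.presheaf.obj U) (SymmetricAlgebra (O.presheaf.obj V) (L.obj V)) :=
    ((algebraMap (O.presheaf.obj V) (SymmetricAlgebra (O.presheaf.obj V) (L.obj V))).comp
      (O.presheaf.map i).hom.toRingHom).toAlgebra
  exact AlgHom.commutes (SymmetricAlgebra.lift _) a

theorem symMap_ι {U V : (Opens X)ᵒᵖ} (i : U ⟶ V) (s : L.obj U) :
    L.symMap i (SymmetricAlgebra.ι _ _ s) = SymmetricAlgebra.ι _ _ (L.res i s) := by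
  let _ : Algebra (O.presheaf.obj U) (SymmetricAlgebra (O.presheaf.obj V) (L.obj V)) :=
    ((algebraMap (O.presheaf.obj V) (SymmetricAlgebra (O.presheaf.obj V) (L.obj V))).comp
      (O.presheaf.map i).hom.toRingHom).toAlgebra
  exact SymmetricAlgebra.lift_ι_apply _ s

theorem sym_hom_ext {U : (Opens X)ᵒᵖ} {R : Type u} [Ring R]
    {f g : SymmetricAlgebra (O.presheaf.obj U) (L.obj U) →+* R}
    (hA : ∀ a, f (algebraMap (O.presheaf.obj U) _ a) = g (algebraMap (O.presheaf.obj U) _ a))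
    (hL : ∀ s, f (SymmetricAlgebra.ι _ _ s) = g (SymmetricAlgebra.ι _ _ s)) : f = g := by
  refine RingHom.ext fun a => ?_
  induction a using SymmetricAlgebra.induction with
  | algebraMap r => exact hA r
  | ι x => exact hL x
  | mul a b ha hb => rw [map_mul, map_mul, ha, hb]
  | add a b ha hb => rw [map_add, map_add, ha, hb]

/-- The presheaf `U ↦ S_{O(U)} L(U)` of symmetric algebras. -/
def symPresheaf : TopCat.Presheaf RingCat.{u} X where
  obj U := RingCat.of (SymmetricAlgebra (O.presheaf.obj U) (L.obj U))
  map i := RingCat.ofHom (L.symMap i)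
  map_id U := by
    ext1
    apply L.sym_hom_ext
    · intro a
      change L.symMap (𝟙 U) _ = _
      rw [symMap_algebraMap, O.presheaf.map_id]; rfl
    · intro s
      change L.symMap (𝟙 U) _ = _
      rw [symMap_ι, L.res_id]; rfl
  map_comp i j := by
    ext1
    apply L.sym_hom_ext
    · intro a
      change L.symMap (i ≫ j) _ = L.symMap j (L.symMap i _)
      rw [symMap_algebraMap, symMap_algebraMap, symMap_algebraMap, O.presheaf.map_comp]; rfl
    · intro s
      change L.symMap (i ≫ j) _ = L.symMap j (L.symMap i _)
      rw [symMap_ι, symMap_ι, symMap_ι, L.res_comp]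

/-- The sheaf `S_O L` of symmetric algebras. -/
def symSheaf : TopCat.Sheaf RingCat.{u} X :=
  (presheafToSheaf (Opens.grothendieckTopology X) RingCat.{u}).obj L.symPresheaf

/-- The `O`-algebra structure `O(U) → (S_O L)(U)`. -/
def symStr (U : Opens X) (f : O.presheaf.obj (op U)) : L.symSheaf.presheaf.obj (op U) :=
  ((toSheafify (Opens.grothendieckTopology X) L.symPresheaf).app (op U)).hom
    (algebraMap (O.presheaf.obj (op U)) (SymmetricAlgebra (O.presheaf.obj (op U)) (L.obj (op U))) f)

/-- The canonical map `L(U) → (S_O L)(U)`. -/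
def symι (U : Opens X) (D : L.obj (op U)) : L.symSheaf.presheaf.obj (op U) :=
  ((toSheafify (Opens.grothendieckTopology X) L.symPresheaf).app (op U)).hom
    (SymmetricAlgebra.ι (O.presheaf.obj (op U)) (L.obj (op U)) D)

/-! ### The universal enveloping algebroid and its associated graded sheaf -/

/-- The presheaf `U ↦ 𝒰(O(U), L(U))` of universal enveloping algebras. -/
def envPresheaf : TopCat.Presheaf RingCat.{u} X where
  obj U := RingCat.of (EnvelopingAlgebra K (O.presheaf.obj U) (L.obj U))
  map i := RingCat.ofHom (EnvelopingAlgebra.map (L.res i)).toRingHom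
  map_id U := by
    have h : EnvelopingAlgebra.map (L.res (𝟙 U)) = AlgHom.id K _ := by
      apply EnvelopingAlgebra.hom_ext
      · intro a
        rw [EnvelopingAlgebra.map_ιA, O.presheaf.map_id]; rfl
      · intro s
        rw [EnvelopingAlgebra.map_ιL, L.res_id]; rfl
    rw [h]; rfl
  map_comp i j := by
    have h : EnvelopingAlgebra.map (L.res (i ≫ j)) =
        (EnvelopingAlgebra.map (L.res j)).comp (EnvelopingAlgebra.map (L.res i)) := by
      apply EnvelopingAlgebra.hom_ext
      · intro a
        rw [AlgHom.comp_apply]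
        simp only [EnvelopingAlgebra.map_ιA]
        rw [O.presheaf.map_comp]; rfl
      · intro s
        rw [AlgHom.comp_apply]
        simp only [EnvelopingAlgebra.map_ιL]
        rw [L.res_comp]
    rw [h]; rfl

/-- The universal enveloping algebroid `𝒰(O, L)`: the sheafification of the presheaf of universal
enveloping algebras. -/
def envSheaf : TopCat.Sheaf RingCat.{u} X :=
  (presheafToSheaf (Opens.grothendieckTopology X) RingCat.{u}).obj L.envPresheaf

/-- The canonical map from `𝒰(O(U), L(U))` to the sections over `U` of `𝒰(O, L)`. -/
def toEnvSheaf (U : Opens X) :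
    EnvelopingAlgebra K (O.presheaf.obj (op U)) (L.obj (op U)) →+*
      L.envSheaf.presheaf.obj (op U) :=
  ((toSheafify (Opens.grothendieckTopology X) L.envPresheaf).app (op U)).hom

theorem toEnvSheaf_res {U V : Opens X} (i : V ⟶ U)
    (t : EnvelopingAlgebra K (O.presheaf.obj (op U)) (L.obj (op U))) :
    (L.envSheaf.presheaf.map i.op).hom (L.toEnvSheaf U t) =
      L.toEnvSheaf V (EnvelopingAlgebra.map (L.res i.op) t) :=
  (congrArg (fun f => f.hom t)
    ((toSheafify (Opens.grothendieckTopology X) L.envPresheaf).naturality i.op)).symm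

/-- `s` is locally the image of a section of the presheaf `U ↦ 𝒰_(n)(O(U), L(U))`. -/
def InFiltration (n : ℕ) {U : Opens X} (s : L.envSheaf.presheaf.obj (op U)) : Prop :=
  ∀ x ∈ U, ∃ (V : Opens X) (_ : x ∈ V) (i : V ⟶ U),
    ∃ t ∈ EnvelopingAlgebra.filtrationStep K (O.presheaf.obj (op V)) (L.obj (op V)) n,
      (L.envSheaf.presheaf.map i.op).hom s = L.toEnvSheaf V t

theorem inFiltration_toEnvSheaf {n : ℕ} {U : Opens X}
    {t : EnvelopingAlgebra K (O.presheaf.obj (op U)) (L.obj (op U))}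
    (ht : t ∈ EnvelopingAlgebra.filtrationStep K (O.presheaf.obj (op U)) (L.obj (op U)) n) :
    L.InFiltration n (L.toEnvSheaf U t) :=
  fun _ hx => ⟨U, hx, 𝟙 U, _, EnvelopingAlgebra.map_mem _ ht, L.toEnvSheaf_res _ _⟩

variable {L} in
theorem InFiltration.res {n : ℕ} {U V : Opens X} {s : L.envSheaf.presheaf.obj (op U)}
    (hs : L.InFiltration n s) (i : V ⟶ U) :
    L.InFiltration n ((L.envSheaf.presheaf.map i.op).hom s) := by
  intro x hx
  obtain ⟨W, hxW, j, t, ht, e⟩ := hs x (i.le hx)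
  refine ⟨V ⊓ W, ⟨hx, hxW⟩, Opens.infLELeft V W,
    EnvelopingAlgebra.map (L.res (Opens.infLERight V W).op) t, EnvelopingAlgebra.map_mem _ ht, ?_⟩
  rw [← toEnvSheaf_res, ← e, ← RingCat.comp_apply, ← RingCat.comp_apply,
    ← Functor.map_comp, ← Functor.map_comp]
  rfl

variable {L} in
theorem InFiltration.map₂ {m n k : ℕ} {U : Opens X} {s s' : L.envSheaf.presheaf.obj (op U)}
    (hs : L.InFiltration m s) (hs' : L.InFiltration n s')
    (op₂ : ∀ (R : Type u) [Ring R], R → R → R)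
    (hop : ∀ {R R' : Type u} [Ring R] [Ring R'] (f : R →+* R') (a b : R),
      f (op₂ R a b) = op₂ R' (f a) (f b))
    (hmem : ∀ (V : Opens X) t t',
      t ∈ EnvelopingAlgebra.filtrationStep K (O.presheaf.obj (op V)) (L.obj (op V)) m →
      t' ∈ EnvelopingAlgebra.filtrationStep K (O.presheaf.obj (op V)) (L.obj (op V)) n →
      op₂ _ t t' ∈ EnvelopingAlgebra.filtrationStep K (O.presheaf.obj (op V)) (L.obj (op V)) k) :
    L.InFiltration k (op₂ (L.envSheaf.presheaf.obj (op U)) s s') := by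
  intro x hx
  obtain ⟨V, hxV, i, t, ht, e⟩ := hs x hx
  obtain ⟨V', hxV', i', t', ht', e'⟩ := hs' x hx
  refine ⟨V ⊓ V', ⟨hxV, hxV'⟩, Opens.infLELeft V V' ≫ i, _,
    hmem _ _ _ (EnvelopingAlgebra.map_mem (L.res (Opens.infLELeft V V').op) ht)
      (EnvelopingAlgebra.map_mem (L.res (Opens.infLERight V V').op) ht'), ?_⟩
  rw [hop, hop, ← toEnvSheaf_res, ← toEnvSheaf_res, ← e, ← e', ← RingCat.comp_apply,
    ← RingCat.comp_apply, ← Functor.map_comp, ← Functor.map_comp]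
  rfl

/-- The filtration of `𝒰(O, L)(U)` by the sections over `U` of the subsheaves `𝒰_(n)(O, L)`, where
`𝒰_(n)(O, L)` is the sheafification of `U ↦ 𝒰_(n)(O(U), L(U))`. -/
def envFiltration (U : Opens X) : RingFiltration (L.envSheaf.presheaf.obj (op U)) where
  F n :=
    { carrier := {s | L.InFiltration n s}
      zero_mem' := by
        have h := L.inFiltration_toEnvSheaf (U := U) (n := n) (zero_mem _)
        rwa [map_zero] at h
      add_mem' := fun hs ht =>
        InFiltration.map₂ hs ht (fun _ _ a b => a + b) (fun f a b => map_add f a b)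
          (fun _ _ _ h h' => add_mem h h')
      neg_mem' := fun hs =>
        InFiltration.map₂ hs hs (fun _ _ a _ => -a) (fun f a _ => map_neg f a)
          (fun _ _ _ h _ => neg_mem h) }
  mono m n hmn s hs x hx := by
    obtain ⟨V, hxV, i, t, ht, e⟩ := hs x hx
    exact ⟨V, hxV, i, t, EnvelopingAlgebra.filtrationStep_mono hmn ht, e⟩
  one_mem := by
    have h := L.inFiltration_toEnvSheaf (U := U) (EnvelopingAlgebra.ιA_mem 1)
    rwa [map_one, map_one] at h
  mul_mem hs ht :=
    InFiltration.map₂ hs ht (fun _ _ a b => a * b) (fun f a b => map_mul f a b)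
      (fun _ _ _ h h' => EnvelopingAlgebra.filtrationStep_mul_mem h h')

theorem isFiltered_res {U V : Opens X} (i : V ⟶ U) :
    (L.envFiltration U).IsFiltered (L.envFiltration V) (L.envSheaf.presheaf.map i.op).hom :=
  fun _ _ hs => InFiltration.res hs i

/-- The presheaf `U ↦ ⨁ n, 𝒰_(n)(O, L)(U) / 𝒰_(n-1)(O, L)(U)` of graded rings. -/
def grPresheaf : TopCat.Presheaf RingCat.{u} X where
  obj U := RingCat.of (L.envFiltration U.unop).Gr
  map i := RingCat.ofHom (RingFiltration.grMap (L.isFiltered_res i.unop))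
  map_id U := by
    ext1
    apply RingFiltration.gr_hom_ext
    intro n a ha
    change RingFiltration.grMap _ _ = _
    rw [RingFiltration.grMap_symbol]
    change _ = (L.envFiltration U.unop).symbol n a ha
    congr 1
    change (L.envSheaf.presheaf.map (𝟙 U)).hom a = a
    rw [CategoryTheory.Functor.map_id]; rfl
  map_comp i j := by
    have h : RingFiltration.grMap (L.isFiltered_res (i ≫ j).unop) =
        (RingFiltration.grMap (L.isFiltered_res j.unop)).comp
          (RingFiltration.grMap (L.isFiltered_res i.unop)) := by
      apply RingFiltration.gr_hom_ext
      intro n a ha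
      rw [RingHom.comp_apply, RingFiltration.grMap_symbol, RingFiltration.grMap_symbol,
        RingFiltration.grMap_symbol]
      congr 1
      change (L.envSheaf.presheaf.map (i ≫ j)).hom a = _
      rw [CategoryTheory.Functor.map_comp]; rfl
    rw [h]; rfl

/-- The sheaf of graded algebras `gr 𝒰(O, L) = ⨁ n, 𝒰_(n)(O, L) / 𝒰_(n-1)(O, L)`. Quotients and
infinite direct sums of sheaves are the sheafifications of the quotients and direct sums taken in
presheaves. -/
def grSheaf : TopCat.Sheaf RingCat.{u} X :=
  (presheafToSheaf (Opens.grothendieckTopology X) RingCat.{u}).obj L.grPresheaf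

/-- The section of `gr 𝒰(O, L)` given by the symbol of degree `n` of a section of `𝒰_(n)(O, L)`. -/
def grSymbol (U : Opens X) (n : ℕ) (s : L.envSheaf.presheaf.obj (op U))
    (hs : s ∈ (L.envFiltration U).F n) : L.grSheaf.presheaf.obj (op U) :=
  ((toSheafify (Opens.grothendieckTopology X) L.grPresheaf).app (op U)).hom
    ((L.envFiltration U).symbol n s hs)

/-- The `O`-algebra structure `O(U) → (gr 𝒰(O, L))(U)`, with values in degree `0`. -/
def grStr (U : Opens X) (f : O.presheaf.obj (op U)) : L.grSheaf.presheaf.obj (op U) :=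
  L.grSymbol U 0 (L.toEnvSheaf U (EnvelopingAlgebra.ιA K _ _ f))
    (L.inFiltration_toEnvSheaf (EnvelopingAlgebra.ιA_mem f))

/-- The canonical map `L(U) → (gr 𝒰(O, L))(U)`, sending `D` to its class in degree `1`. -/
def grι (U : Opens X) (D : L.obj (op U)) : L.grSheaf.presheaf.obj (op U) :=
  L.grSymbol U 1 (L.toEnvSheaf U (EnvelopingAlgebra.ιL K _ _ D))
    (L.inFiltration_toEnvSheaf (EnvelopingAlgebra.ιL_mem D))

end LieAlgebroid

end

/-! Commutators in `𝒰` lower the filtration degree (`EnvelopingAlgebra.commutator_mem`), so the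
graded ring of sections is commutative, and functions in degree 0 together with vectors in degree 1
define a ring map out of `S(L(U))`, namely `symToGr`. Sheafification inverts every morphism of
presheaves that is locally injective and locally surjective, so it suffices to check these two
properties for `symToGrPresheaf`.

Local surjectivity needs no freeness. A section of `𝒰_(n)` is locally a sum of products `a D₁ ⋯ Dₘ`
with `m ≤ n`. Those with `m = n` have symbols that are visibly images, and the shorter ones have
symbol zero (`exists_symToGr_eq_res`).

Local injectivity is the Poincaré–Birkhoff–Witt theorem. When `L` is free over `A` on a linearly
ordered basis, `𝒰(A, L)` acts on the polynomial ring `A[X_i]` so that `x ∈ L` acts as multiplication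
by its linear form plus an operator that does not raise the degree (`act_lie`, `act_sub_mem_degLE`).
Hence the degree-`n` part of `u · 1` depends, for `u` of filtration degree `n`, only on the symbol
of `u`, and it sends `a x₁ ⋯ xₙ` to `a` times the product of the linear forms
(`pbwSymbol_ιA_mul_prod`, `pbwSymbol_eq_zero`).

This cannot be applied to `L(V)` itself: for an infinite basis, sections over `V` are only locally
finite combinations of basis sections, so `L(V)` need not be free over `O(V)`. The stalk of `L` at a
point is free, on the germs of a local basis (`IsLocalBasis.stalkBasis`). An element `p` killed by
`symToGr` therefore has zero image in the polynomial ring over the stalk of `O` (`symGerm_eq_zero`).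
Near the point, `p` is a polynomial in the basis sections; its finitely many coefficients have zero
germ, so they vanish on a common smaller neighbourhood, and so does `p`
(`IsLocalBasis.exists_symMap_eq_zero`). -/

noncomputable section

/-! ### The Poincaré–Birkhoff–Witt representation of a free Lie–Rinehart algebra

For a Lie–Rinehart algebra `L` over `A`, free with basis `b : Basis I A L`, we construct an action
of `𝒰(A, L)` on the polynomial ring `A[X_i | i ∈ I]` for which `x ∈ L` acts by multiplication with
the linear form of `x`, up to terms of lower degree. -/

namespace LieRinehartAlgebra

open MvPolynomial

/-! ### Polynomials of bounded degree -/

section DegLE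

variable (I A : Type u) [CommRing A]

/-- The polynomials of total degree at most `n`, as the span of monomials. -/
def degLE (n : ℕ) : Submodule A (MvPolynomial I A) :=
  Submodule.span A {q | ∃ J : I →₀ ℕ, J.degree ≤ n ∧ q = monomial J 1}

variable {I A}

theorem monomial_mem_degLE {J : I →₀ ℕ} {n : ℕ} (h : J.degree ≤ n) :
    (monomial J 1 : MvPolynomial I A) ∈ degLE I A n :=
  Submodule.subset_span ⟨J, h, rfl⟩

theorem degLE_mono {m n : ℕ} (h : m ≤ n) : degLE I A m ≤ degLE I A n :=
  Submodule.span_mono fun _ ⟨J, hJ, e⟩ => ⟨J, hJ.trans h, e⟩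

theorem exists_mem_degLE (p : MvPolynomial I A) : ∃ n, p ∈ degLE I A n := by
  induction p using MvPolynomial.induction_on' with
  | monomial J a =>
    refine ⟨J.degree, ?_⟩
    have h : monomial J a = a • (monomial J 1 : MvPolynomial I A) := by simp [smul_monomial]
    rw [h]
    exact Submodule.smul_mem _ _ (monomial_mem_degLE le_rfl)
  | add p q hp hq =>
    obtain ⟨m, hm⟩ := hp
    obtain ⟨n, hn⟩ := hq
    exact ⟨max m n, add_mem (degLE_mono (le_max_left _ _) hm) (degLE_mono (le_max_right _ _) hn)⟩

theorem X_mul_monomial (i : I) (J : I →₀ ℕ) :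
    (X i * monomial J 1 : MvPolynomial I A) = monomial (J + Finsupp.single i 1) 1 := by
  rw [monomial_add_single, pow_one, mul_comm]

theorem X_mul_mem_degLE (i : I) {n : ℕ} {p : MvPolynomial I A} (hp : p ∈ degLE I A n) :
    X i * p ∈ degLE I A (n + 1) := by
  induction hp using Submodule.span_induction with
  | mem p hp =>
    obtain ⟨J, hJ, rfl⟩ := hp
    rw [X_mul_monomial]
    exact monomial_mem_degLE (by simpa using hJ)
  | zero => simp
  | add p q _ _ hp hq => rw [mul_add]; exact add_mem hp hq
  | smul a p _ hp => rw [mul_smul_comm]; exact Submodule.smul_mem _ _ hp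

theorem homogeneousComponent_eq_zero_of_mem_degLE {m n : ℕ} (h : m < n) {p : MvPolynomial I A}
    (hp : p ∈ degLE I A m) : homogeneousComponent n p = 0 := by
  induction hp using Submodule.span_induction with
  | mem p hp =>
    obtain ⟨J, hJ, rfl⟩ := hp
    rw [homogeneousComponent_of_mem (isHomogeneous_monomial 1 rfl), if_neg]
    omega
  | zero => simp
  | add p q _ _ hp hq => rw [map_add, hp, hq, add_zero]
  | smul a p _ hp => rw [map_smul, hp, smul_zero]

end DegLE

/-! ### The anchor acting on coefficients -/

section CoeffLie

variable {A L : Type u} [CommRing A] [LieRing L] [LieRingModule L A]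

/-- The action of `x ∈ L` on the coefficients of polynomials. -/
def coeffLie (I : Type u) (x : L) : MvPolynomial I A →+ MvPolynomial I A where
  toFun p := AddMonoidAlgebra.ofCoeff
    (Finsupp.mapRange (fun a => ⁅x, a⁆) (lie_zero x) (AddMonoidAlgebra.coeff p))
  map_zero' := by ext J; simp [MvPolynomial.coeff]
  map_add' p q := by ext J; simp [MvPolynomial.coeff]

variable {I : Type u}

theorem coeff_coeffLie (x : L) (p : MvPolynomial I A) (J : I →₀ ℕ) :
    MvPolynomial.coeff J (coeffLie I x p) = ⁅x, MvPolynomial.coeff J p⁆ := by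
  simp [coeffLie, MvPolynomial.coeff]

theorem coeffLie_add (x y : L) (p : MvPolynomial I A) :
    coeffLie I (x + y) p = coeffLie I x p + coeffLie I y p := by
  ext J; simp [coeff_coeffLie]

variable [Module A L] [LieRinehartRing A L]

theorem coeffLie_smul (a : A) (x : L) (p : MvPolynomial I A) :
    coeffLie I (a • x) p = a • coeffLie I x p := by
  ext J; simp [coeff_coeffLie]

/-- This Leibniz term is the only failure of `A`-linearity in the final action; it produces the
relation `x · a - a · x = ⁅x, a⁆`. -/
theorem coeffLie_apply_smul (x : L) (a : A) (p : MvPolynomial I A) :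
    coeffLie I x (a • p) = a • coeffLie I x p + ⁅x, a⁆ • p := by
  ext J; simp [coeff_coeffLie]

theorem lie_one_eq_zero (x : L) : ⁅x, (1 : A)⁆ = 0 := by
  have h := LieRinehartRing.leibniz_mul_right x (1 : A) 1
  simpa using h

/-- Derivations kill `1`, so on monomials the action reduces to its `A`-linear part. -/
theorem coeffLie_monomial (x : L) (J : I →₀ ℕ) :
    coeffLie I x (monomial J (1 : A)) = 0 := by
  classical
  ext J'
  rw [coeff_coeffLie, coeff_monomial]
  split_ifs <;> simp [lie_one_eq_zero]

theorem coeffLie_mem_degLE (x : L) {n : ℕ} {p : MvPolynomial I A} (hp : p ∈ degLE I A n) :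
    coeffLie I x p ∈ degLE I A n := by
  induction hp using Submodule.span_induction with
  | mem p hp =>
    obtain ⟨J, hJ, rfl⟩ := hp
    rw [coeffLie_monomial]; exact zero_mem _
  | zero => simp
  | add p q _ _ hp hq => rw [map_add]; exact add_mem hp hq
  | smul a p hp' hp =>
    rw [coeffLie_apply_smul]
    exact add_mem (Submodule.smul_mem _ _ hp) (Submodule.smul_mem _ _ hp')

end CoeffLie

/-! ### Bilinear operators given on a basis, and their leading terms -/

section Bilinear

variable {A L I : Type u} [CommRing A] [AddCommGroup L] [Module A L] (b : Module.Basis I A L)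

/-- The linear form `∑ aᵢ Xᵢ` attached to `x = ∑ aᵢ bᵢ`. -/
def linForm : L →ₗ[A] MvPolynomial I A :=
  b.constr A X

theorem linForm_basis (i : I) : linForm b (b i) = X i :=
  b.constr_basis A X i

/-- The bilinear operator `L × A[X] → A[X]` with prescribed values `t i J` on `(bᵢ, X^J)`. -/
def bilinOfBasis (t : I → (I →₀ ℕ) → MvPolynomial I A) :
    L →ₗ[A] MvPolynomial I A →ₗ[A] MvPolynomial I A :=
  b.constr A fun i => (basisMonomials I A).constr A (t i)

theorem bilinOfBasis_apply (t : I → (I →₀ ℕ) → MvPolynomial I A) (i : I) (J : I →₀ ℕ) :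
    bilinOfBasis b t (b i) (monomial J 1) = t i J := by
  rw [bilinOfBasis, Module.Basis.constr_basis]
  have h := (basisMonomials I A).constr_basis A (t i) J
  rwa [coe_basisMonomials] at h

variable {b}

theorem basis_induction {motive : L → Prop} (x : L) (basis : ∀ i, motive (b i))
    (zero : motive 0) (add : ∀ x y, motive x → motive y → motive (x + y))
    (smul : ∀ (a : A) x, motive x → motive (a • x)) : motive x := by
  induction b.mem_span x using Submodule.span_induction with
  | mem x hx => obtain ⟨i, rfl⟩ := hx; exact basis i
  | zero => exact zero
  | add x y _ _ hx hy => exact add x y hx hy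
  | smul a x _ hx => exact smul a x hx

theorem linForm_mul_mem_degLE (x : L) {n : ℕ} {p : MvPolynomial I A} (hp : p ∈ degLE I A n) :
    linForm b x * p ∈ degLE I A (n + 1) := by
  induction x using basis_induction (b := b) with
  | basis i => rw [linForm_basis]; exact X_mul_mem_degLE i hp
  | zero => simp
  | add x y hx hy => rw [map_add, add_mul]; exact add_mem hx hy
  | smul a x hx => rw [map_smul, smul_mul_assoc]; exact Submodule.smul_mem _ _ hx

theorem homogeneousComponent_linForm_mul (n : ℕ) (x : L)
    (p : MvPolynomial I A) :
    homogeneousComponent (n + 1) (linForm b x * p) = linForm b x * homogeneousComponent n p := by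
  induction x using basis_induction (b := b) with
  | basis i =>
    rw [linForm_basis]
    induction p using MvPolynomial.induction_on' with
    | monomial J a =>
      have e : (X i * monomial J a : MvPolynomial I A) = monomial (J + Finsupp.single i 1) a := by
        rw [monomial_add_single, pow_one, mul_comm]
      rw [e, homogeneousComponent_of_mem (isHomogeneous_monomial a rfl),
        homogeneousComponent_of_mem (isHomogeneous_monomial a rfl)]
      have hd : (J + Finsupp.single i 1).degree = J.degree + 1 := by simp
      rw [hd]
      by_cases h : n = J.degree
      · rw [if_pos h, if_pos (by rw [h]), e]
      · rw [if_neg h, if_neg (fun h' => h (Nat.succ_injective h')), mul_zero]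
    | add p q hp hq => simp only [mul_add, map_add, hp, hq]
  | zero => simp
  | add x y hx hy => simp only [map_add, add_mul, hx, hy]
  | smul a x hx => simp only [map_smul, smul_mul_assoc, hx]

variable {T T' : L →ₗ[A] MvPolynomial I A →ₗ[A] MvPolynomial I A}

theorem eq_on_degLE_of_basis {n : ℕ}
    (h : ∀ i J, J.degree ≤ n → T (b i) (monomial J 1) = T' (b i) (monomial J 1))
    (x : L) {p : MvPolynomial I A} (hp : p ∈ degLE I A n) : T x p = T' x p := by
  induction hp using Submodule.span_induction with
  | mem p hp =>
    obtain ⟨J, hJ, rfl⟩ := hp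
    induction x using basis_induction (b := b) with
    | basis i => exact h i J hJ
    | zero => simp
    | add x y hx hy => simp only [map_add, LinearMap.add_apply, hx, hy]
    | smul a x hx => simp only [map_smul, LinearMap.smul_apply, hx]
  | zero => simp
  | add p q _ _ hp hq => rw [map_add, map_add, hp, hq]
  | smul a p _ hp => rw [map_smul, map_smul, hp]

/-- The condition "multiplication by the linear form plus terms of no higher degree" is bilinear in
`x` and `p`, so it only has to be checked on basis vectors and monomials. -/
theorem sub_mem_degLE_of_basis
    (hT : ∀ i J, T (b i) (monomial J 1) - X i * monomial J 1 ∈ degLE I A J.degree)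
    (x : L) {n : ℕ} {p : MvPolynomial I A} (hp : p ∈ degLE I A n) :
    T x p - linForm b x * p ∈ degLE I A n := by
  induction hp using Submodule.span_induction with
  | mem p hp =>
    obtain ⟨J, hJ, rfl⟩ := hp
    induction x using basis_induction (b := b) with
    | zero => simp
    | add x y hx hy =>
      have e : T (x + y) (monomial J 1) - linForm b (x + y) * monomial J 1 =
        (T x (monomial J 1) - linForm b x * monomial J 1) +
          (T y (monomial J 1) - linForm b y * monomial J 1) := by
        simp only [map_add, LinearMap.add_apply, add_mul]; abel
      rw [e]; exact add_mem hx hy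
    | smul a x hx =>
      have e : T (a • x) (monomial J 1) - linForm b (a • x) * monomial J 1 =
        a • (T x (monomial J 1) - linForm b x * monomial J 1) := by
        simp only [map_smul, LinearMap.smul_apply, smul_mul_assoc, smul_sub]
      rw [e]; exact Submodule.smul_mem _ _ hx
    | basis i => rw [linForm_basis]; exact degLE_mono hJ (hT i J)
  | zero => simp
  | add p q _ _ hp hq =>
    have e : T x (p + q) - linForm b x * (p + q) =
      (T x p - linForm b x * p) + (T x q - linForm b x * q) := by
      simp only [map_add, mul_add]; abel
    rw [e]; exact add_mem hp hq
  | smul a p _ hp =>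
    rw [map_smul, mul_smul_comm, ← smul_sub]; exact Submodule.smul_mem _ _ hp

theorem apply_mem_degLE_of_basis
    (hT : ∀ i J, T (b i) (monomial J 1) - X i * monomial J 1 ∈ degLE I A J.degree)
    (x : L) {n : ℕ} {p : MvPolynomial I A} (hp : p ∈ degLE I A n) :
    T x p ∈ degLE I A (n + 1) := by
  rw [← sub_add_cancel (T x p) (linForm b x * p)]
  exact add_mem (degLE_mono n.le_succ (sub_mem_degLE_of_basis hT x hp))
    (linForm_mul_mem_degLE x hp)

end Bilinear

/-! ### Construction of the action and its commutation relations -/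

section Action

/-- A monomial either has no variable smaller than `i`, or it has a smallest variable `j < i`. -/
theorem forall_le_or_exists_min {I : Type u} [LinearOrder I] (i : I) (J : I →₀ ℕ) :
    (∀ j ∈ J.support, i ≤ j) ∨ ∃ (j : I) (J' : I →₀ ℕ), j < i ∧ (∀ k ∈ J'.support, j ≤ k) ∧
      J = J' + Finsupp.single j 1 := by
  by_cases h : ∃ j ∈ J.support, j < i
  · right
    obtain ⟨k, hk, hki⟩ := h
    have hne : J.support.Nonempty := ⟨k, hk⟩
    have hmem : J.support.min' hne ∈ J.support := J.support.min'_mem _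
    refine ⟨J.support.min' hne, J - Finsupp.single (J.support.min' hne) 1,
      (Finset.min'_le _ _ hk).trans_lt hki, fun l hl => Finset.min'_le _ _ ?_, ?_⟩
    · have := Finsupp.support_tsub hl
      exact this
    · refine (tsub_add_cancel_of_le ?_).symm
      rw [Finsupp.single_le_iff]
      exact Nat.one_le_iff_ne_zero.2 (Finsupp.mem_support_iff.1 hmem)
  · left
    push Not at h
    exact h

variable {A L I : Type u} [CommRing A] [LieRing L] [Module A L] [LieRingModule L A]
  [LinearOrder I] (b : Module.Basis I A L)

/-- The `A`-linear part of the action, computed by `n` rounds of the recursion that moves the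
smallest variable of a monomial to the left. It is stable on polynomials of degree at most `n`. -/
def approx : ℕ → L →ₗ[A] MvPolynomial I A →ₗ[A] MvPolynomial I A
  -- Guaranteed to be the right value only on constants; beyond them it is a starting value for the
  -- recursion.
  | 0 => bilinOfBasis b fun i J => X i * monomial J 1
  | n + 1 => bilinOfBasis b fun i J =>
      X i * monomial J 1 +
        if h : ∃ j ∈ J.support, j < i then
          -- With `p = X^J / X_j`, the monomial is `b_j · p`, and the action must satisfy `b_i b_j p
          -- = b_j b_i p + ⁅b_i, b_j⁆ p`. Write `b_i p = X_i p + w`. Since `j` is smallest, `b_j`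
          -- multiplies `X_i p` by `X_j`, giving the leading term; `b_j w` splits into its
          -- coefficient part and its linear part, and the bracket term remains.
          let j := J.support.min' ⟨h.choose, h.choose_spec.1⟩
          let p : MvPolynomial I A := monomial (J - Finsupp.single j 1) 1
          coeffLie I (b j) (approx n (b i) p - X i * p) +
            approx n (b j) (approx n (b i) p - X i * p) + approx n ⁅b i, b j⁆ p
        else 0

theorem approx_of_le (n : ℕ) {i : I} {J : I →₀ ℕ} (h : ∀ j ∈ J.support, i ≤ j) :
    approx b n (b i) (monomial J 1) = X i * monomial J 1 := by
  cases n with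
  | zero => rw [approx, bilinOfBasis_apply]
  | succ n =>
    rw [approx, bilinOfBasis_apply, dif_neg, add_zero]
    rintro ⟨j, hj, hji⟩
    exact absurd (h j hj) (not_le.2 hji)

theorem approx_succ (n : ℕ) {i j : I} {J : I →₀ ℕ} (hji : j < i) (h : ∀ k ∈ J.support, j ≤ k) :
    approx b (n + 1) (b i) (monomial (J + Finsupp.single j 1) 1) =
      X i * monomial (J + Finsupp.single j 1) 1 +
        (coeffLie I (b j) (approx b n (b i) (monomial J 1) - X i * monomial J 1) +
          approx b n (b j) (approx b n (b i) (monomial J 1) - X i * monomial J 1) +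
            approx b n ⁅b i, b j⁆ (monomial J 1)) := by
  have hj : j ∈ (J + Finsupp.single j 1).support := by simp
  have hex : ∃ k ∈ (J + Finsupp.single j 1).support, k < i := ⟨j, hj, hji⟩
  -- The smallest variable picked by the definition is the `j` split off here.
  have hmin : (J + Finsupp.single j 1).support.min' ⟨hex.choose, hex.choose_spec.1⟩ = j := by
    refine le_antisymm (Finset.min'_le _ _ hj) (Finset.le_min' _ _ _ fun k hk => ?_)
    by_cases hkj : k = j
    · exact hkj.ge
    · apply h
      simpa [Finsupp.single_apply, Ne.symm hkj] using hk
  rw [approx, bilinOfBasis_apply, dif_pos hex]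
  simp only [hmin, add_tsub_cancel_right]

/-- The `A`-linear part of the action of `L` on `A[X]`. -/
def linPart : L →ₗ[A] MvPolynomial I A →ₗ[A] MvPolynomial I A :=
  bilinOfBasis b fun i J => approx b J.degree (b i) (monomial J 1)

/-- The action of `x ∈ L` on `A[X]`. -/
def act (x : L) : MvPolynomial I A →+ MvPolynomial I A :=
  coeffLie I x + (linPart b x).toAddMonoidHom

theorem act_apply (x : L) (p : MvPolynomial I A) :
    act b x p = coeffLie I x p + linPart b x p := rfl

theorem act_add (x y : L) (p : MvPolynomial I A) : act b (x + y) p = act b x p + act b y p := by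
  simp only [act_apply, coeffLie_add, map_add, LinearMap.add_apply]; abel

/-- The operators satisfy the commutation relation of `x` and `y` on `p`. -/
def ActCommutes (x y : L) (p : MvPolynomial I A) : Prop :=
  act b x (act b y p) - act b y (act b x p) = act b ⁅x, y⁆ p

theorem ActCommutes.add_right {b} {x y : L} {p q : MvPolynomial I A}
    (hp : ActCommutes b x y p) (hq : ActCommutes b x y q) : ActCommutes b x y (p + q) := by
  unfold ActCommutes at hp hq ⊢
  simp only [map_add, ← hp, ← hq]
  abel

theorem ActCommutes.add_left {b} {x x' y : L} {p : MvPolynomial I A}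
    (h : ActCommutes b x y p) (h' : ActCommutes b x' y p) : ActCommutes b (x + x') y p := by
  unfold ActCommutes at h h' ⊢
  simp only [act_add, map_add, add_lie, ← h, ← h']
  abel

variable [LieRinehartRing A L]

/-- Each correction applies at most one vector to something of degree at most `J.degree - 1`, so it
never exceeds degree `J.degree`. This holds for every number of rounds, before stability is known,
and is what makes the recursion well-founded by degree. -/
theorem approx_sub_mem_degLE (n : ℕ) (i : I) (J : I →₀ ℕ) :
    approx b n (b i) (monomial J 1) - X i * monomial J 1 ∈ degLE I A J.degree := by
  induction n generalizing i J with
  | zero => rw [approx, bilinOfBasis_apply, sub_self]; exact zero_mem _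
  | succ n ih =>
    rcases forall_le_or_exists_min i J with h | ⟨j, J, hji, h, rfl⟩
    · rw [approx_of_le b (n + 1) h, sub_self]; exact zero_mem _
    · rw [approx_succ b n hji h, add_sub_cancel_left]
      have hd : (J + Finsupp.single j 1).degree = J.degree + 1 := by simp
      rw [hd]
      refine add_mem (add_mem ?_ ?_) ?_
      · exact degLE_mono (Nat.le_succ _) (coeffLie_mem_degLE _ (ih i J))
      · exact apply_mem_degLE_of_basis ih _ (ih i J)
      · exact apply_mem_degLE_of_basis ih _ (monomial_mem_degLE le_rfl)

/-- In degree `n + 1` a round consults the previous round only in degrees at most `n`, where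
stability is already known; the remainder `w` stays in that range by `approx_sub_mem_degLE`. -/
theorem approx_succ_eq (n : ℕ) (x : L) {p : MvPolynomial I A} (hp : p ∈ degLE I A n) :
    approx b n x p = approx b (n + 1) x p := by
  refine eq_on_degLE_of_basis (b := b) (fun i J hJ => ?_) x hp
  clear hp
  induction n generalizing i J with
  | zero =>
    have hJ0 : J = 0 := (Finsupp.degree_eq_zero_iff J).1 (Nat.le_zero.1 hJ)
    subst hJ0
    rw [approx_of_le, approx_of_le] <;> simp
  | succ n ih =>
    have ih' : ∀ (x : L) {p : MvPolynomial I A}, p ∈ degLE I A n →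
        approx b n x p = approx b (n + 1) x p :=
      fun x p hp => eq_on_degLE_of_basis (b := b) ih x hp
    rcases forall_le_or_exists_min i J with h | ⟨j, J, hji, h, rfl⟩
    · rw [approx_of_le b _ h, approx_of_le b _ h]
    · have hd : J.degree ≤ n := by simpa using hJ
      have hm : (monomial J 1 : MvPolynomial I A) ∈ degLE I A n := monomial_mem_degLE hd
      rw [approx_succ b _ hji h, approx_succ b _ hji h, ← ih' _ hm, ← ih' _ hm,
        ← ih' _ (degLE_mono hd (approx_sub_mem_degLE b n i J))]

theorem approx_eq_of_le {m n : ℕ} (hmn : m ≤ n) (x : L) {p : MvPolynomial I A}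
    (hp : p ∈ degLE I A m) : approx b m x p = approx b n x p := by
  induction n, hmn using Nat.le_induction with
  | base => rfl
  | succ n hn ih => rw [ih, approx_succ_eq b n x (degLE_mono hn hp)]

theorem linPart_eq {n : ℕ} (x : L) {p : MvPolynomial I A} (hp : p ∈ degLE I A n) :
    linPart b x p = approx b n x p := by
  refine eq_on_degLE_of_basis (b := b) (fun i J hJ => ?_) x hp
  rw [linPart, bilinOfBasis_apply]
  exact approx_eq_of_le b hJ _ (monomial_mem_degLE le_rfl)

theorem act_smul (a : A) (x : L) (p : MvPolynomial I A) : act b (a • x) p = a • act b x p := by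
  simp only [act_apply, coeffLie_smul, map_smul, LinearMap.smul_apply, smul_add]

theorem act_zero (p : MvPolynomial I A) : act b 0 p = 0 := by
  simpa using act_smul b 0 0 p

theorem act_neg (x : L) (p : MvPolynomial I A) : act b (-x) p = -act b x p := by
  simpa using act_smul b (-1) x p

theorem act_sub (x y : L) (p : MvPolynomial I A) : act b (x - y) p = act b x p - act b y p := by
  rw [sub_eq_add_neg, act_add, act_neg, sub_eq_add_neg]

theorem act_apply_smul (x : L) (a : A) (p : MvPolynomial I A) :
    act b x (a • p) = a • act b x p + ⁅x, a⁆ • p := by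
  simp only [act_apply, coeffLie_apply_smul, map_smul, smul_add]; abel

/-- The coefficient part preserves degree and the linear part has the right leading term. This
estimate drives both the proof of the commutation relations and the computation of symbols. -/
theorem act_sub_mem_degLE (x : L) {n : ℕ} {p : MvPolynomial I A} (hp : p ∈ degLE I A n) :
    act b x p - linForm b x * p ∈ degLE I A n := by
  rw [act_apply, linPart_eq b x hp, add_sub_assoc]
  exact add_mem (coeffLie_mem_degLE x hp)
    (sub_mem_degLE_of_basis (approx_sub_mem_degLE b n) x hp)

theorem act_mem_degLE (x : L) {n : ℕ} {p : MvPolynomial I A} (hp : p ∈ degLE I A n) :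
    act b x p ∈ degLE I A (n + 1) := by
  rw [← sub_add_cancel (act b x p) (linForm b x * p)]
  exact add_mem (degLE_mono n.le_succ (act_sub_mem_degLE b x hp)) (linForm_mul_mem_degLE x hp)

theorem act_basis_of_le {i : I} {J : I →₀ ℕ} (h : ∀ j ∈ J.support, i ≤ j) :
    act b (b i) (monomial J 1) = X i * monomial J 1 := by
  rw [act_apply, coeffLie_monomial, zero_add, linPart_eq b _ (monomial_mem_degLE le_rfl),
    approx_of_le b _ h]

/-- The defining recursion, as a commutation relation. -/
theorem actCommutes_of_lt {i j : I} {J : I →₀ ℕ} (hji : j < i) (h : ∀ k ∈ J.support, j ≤ k) :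
    ActCommutes b (b i) (b j) (monomial J 1) := by
  have hm : (monomial J 1 : MvPolynomial I A) ∈ degLE I A J.degree := monomial_mem_degLE le_rfl
  have hd : (J + Finsupp.single j 1).degree = J.degree + 1 := by simp
  -- The remainder of `b_i` on `X^J` has degree at most `J.degree`, so `linPart` may be replaced on
  -- it by the same `approx b J.degree` that occurs in `approx_succ`.
  have hw := act_sub_mem_degLE b (b i) hm
  have h1 : act b (b i) (X j * monomial J 1) = X i * (X j * monomial J 1) +
      (act b (b j) (act b (b i) (monomial J 1) - X i * monomial J 1) +
        act b ⁅b i, b j⁆ (monomial J 1)) := by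
    rw [linForm_basis, act_apply b (b i), coeffLie_monomial, zero_add, linPart_eq b _ hm] at hw
    rw [X_mul_monomial, act_apply b (b i), coeffLie_monomial, zero_add,
      linPart_eq b _ (monomial_mem_degLE hd.le), approx_succ b _ hji h, act_apply b (b i),
      coeffLie_monomial, zero_add, linPart_eq b _ hm, act_apply b (b j), linPart_eq b _ hw,
      act_apply b ⁅b i, b j⁆, coeffLie_monomial, zero_add, linPart_eq b _ hm]
  -- No variable of `X_i X^J` is smaller than `j`, so `b_j` simply multiplies.
  have h2 : act b (b j) (X i * monomial J 1) = X j * (X i * monomial J 1) := by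
    rw [X_mul_monomial]
    refine act_basis_of_le b fun k hk => ?_
    by_cases hki : k = i
    · exact hki ▸ hji.le
    · apply h
      simpa [Finsupp.single_apply, Ne.symm hki] using hk
  rw [ActCommutes, act_basis_of_le b h, h1, map_sub, h2]
  ring

variable {b}

theorem ActCommutes.symm {x y : L} {p : MvPolynomial I A} (h : ActCommutes b x y p) :
    ActCommutes b y x p := by
  rw [ActCommutes, ← lie_skew, act_neg, ← h, neg_sub]

/-- The Leibniz terms on the two sides agree because the anchor respects brackets: `⁅⁅x, y⁆, a⁆ =
⁅x, ⁅y, a⁆⁆ - ⁅y, ⁅x, a⁆⁆`. -/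
theorem ActCommutes.smul_right {x y : L} {p : MvPolynomial I A} (a : A)
    (h : ActCommutes b x y p) : ActCommutes b x y (a • p) := by
  unfold ActCommutes at h ⊢
  simp only [act_apply_smul, map_add, ← h, lie_lie, sub_smul, smul_sub]
  abel

/-- Moving `a` through the action of `y` leaves the term `-⁅y, a⁆ · x p`, which is exactly the
Leibniz term of `⁅a • x, y⁆`. -/
theorem ActCommutes.smul_left {x y : L} {p : MvPolynomial I A} (a : A)
    (h : ActCommutes b x y p) : ActCommutes b (a • x) y p := by
  have e : ⁅a • x, y⁆ = a • ⁅x, y⁆ - ⁅y, a⁆ • x := by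
    rw [← lie_skew, LieRinehartRing.leibniz_smul_right, ← lie_skew x y]
    simp only [smul_neg]
    abel
  unfold ActCommutes at h ⊢
  rw [e, act_sub]
  simp only [act_smul, act_apply_smul, ← h, smul_sub]
  abel

theorem actCommutes_of_basis {p : MvPolynomial I A} (h : ∀ i j, ActCommutes b (b i) (b j) p)
    (x y : L) : ActCommutes b x y p := by
  have hz : ∀ y, ActCommutes b 0 y p := fun y => by simp [ActCommutes, act_zero]
  have h1 : ∀ (x : L) (j : I), ActCommutes b x (b j) p := fun x j => by
    induction x using basis_induction (b := b) with
    | basis i => exact h i j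
    | zero => exact hz _
    | add x y hx hy => exact hx.add_left hy
    | smul a x hx => exact hx.smul_left a
  induction y using basis_induction (b := b) with
  | basis j => exact h1 x j
  | zero => exact (hz x).symm
  | add y z hy hz => exact (hy.symm.add_left hz.symm).symm
  | smul a y hy => exact (hy.symm.smul_left a).symm

theorem actCommutes_of_mem_degLE {n : ℕ} {x y : L}
    (h : ∀ J : I →₀ ℕ, J.degree ≤ n → ActCommutes b x y (monomial J 1))
    {p : MvPolynomial I A} (hp : p ∈ degLE I A n) : ActCommutes b x y p := by
  induction hp using Submodule.span_induction with
  | mem p hp => obtain ⟨J, hJ, rfl⟩ := hp; exact h J hJ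
  | zero => simp [ActCommutes]
  | add p q _ _ hp hq => exact hp.add_right hq
  | smul a p _ hp => exact hp.smul_right a

/-- The inductive step: if the commutation relations of `L` hold on `z` and those of `bₖ` with `x`
and `y` hold on the images of `z`, then those of `x` and `y` hold on `bₖ z`. -/
theorem ActCommutes.act_of_jacobi {x y w : L} {z : MvPolynomial I A}
    (hz : ∀ x y, ActCommutes b x y z)
    (h1 : ActCommutes b x w (act b y z)) (h2 : ActCommutes b y w (act b x z)) :
    ActCommutes b x y (act b w z) := by
  have e1 := hz x w
  have e2 := hz y w
  have e3 := hz x ⁅y, w⁆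
  have e4 := hz y ⁅x, w⁆
  have e5 := hz x y
  have e6 := hz ⁅x, y⁆ w
  unfold ActCommutes at *
  have j : ⁅⁅x, y⁆, w⁆ = ⁅x, ⁅y, w⁆⁆ - ⁅y, ⁅x, w⁆⁆ := lie_lie x y w
  rw [j, act_sub] at e6
  have f1 := congrArg (act b x) e2
  have f2 := congrArg (act b y) e1
  have f5 := congrArg (act b w) e5
  simp only [map_sub] at f1 f2 f5
  -- Move `w` left past `y` and then past `x`, and subtract the same expression with `x` and `y`
  -- exchanged. What remains is `w ⁅x, y⁆ z` plus brackets with `w`, which the Jacobi identity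
  -- collects into `⁅⁅x, y⁆, w⁆ z`.
  linear_combination f1 - f2 + h1 - h2 + e3 - e4 + f5 - e6

/-- Induction on the degree. For `j < i` the relation is built into the recursion unless the
monomial has a variable below `j`. In that case its smallest variable `k` is split off and the
Jacobi identity reduces the claim to relations involving `b_k`. -/
theorem actCommutes_monomial (J : I →₀ ℕ) (x y : L) : ActCommutes b x y (monomial J 1) := by
  induction hn : J.degree using Nat.strong_induction_on generalizing J x y with
  | _ n ih =>
    have key : ∀ i j, j < i → ActCommutes b (b i) (b j) (monomial J 1) := by
      intro i j hji
      rcases forall_le_or_exists_min j J with h | ⟨k, J, hkj, h, rfl⟩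
      · exact actCommutes_of_lt b hji h
      have hd : J.degree + 1 = n := by simpa using hn
      have hz : ∀ x y, ActCommutes b x y (monomial J 1) := fun x y =>
        ih J.degree (by omega) J x y rfl
      have aux : ∀ i j, k < i → k < j → ActCommutes b (b i) (b k) (act b (b j) (monomial J 1)) := by
        intro i j hki hkj
        -- The remainder has smaller degree than the original monomial, so induction applies. The
        -- leading term `X_j X^J` has the full degree, but `k` is at most all its variables, so
        -- there the relation is the defining recursion.
        rw [← sub_add_cancel (act b (b j) (monomial J 1)) (linForm b (b j) * monomial J 1)]
        refine ActCommutes.add_right ?_ ?_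
        · exact actCommutes_of_mem_degLE (n := J.degree)
            (fun J' hJ' => ih J'.degree (by omega) J' _ _ rfl)
            (act_sub_mem_degLE b _ (monomial_mem_degLE le_rfl))
        · rw [linForm_basis, X_mul_monomial]
          refine actCommutes_of_lt b hki fun l hl => ?_
          by_cases hlj : l = j
          · exact hlj ▸ hkj.le
          · apply h
            simpa [Finsupp.single_apply, Ne.symm hlj] using hl
      rw [← X_mul_monomial, ← act_basis_of_le b h]
      exact ActCommutes.act_of_jacobi hz (aux i j (hkj.trans hji) hkj) (aux j i hkj (hkj.trans hji))
    refine actCommutes_of_basis (fun i j => ?_) x y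
    rcases lt_trichotomy i j with h | rfl | h
    · exact (key j i h).symm
    · simp [ActCommutes, act_zero]
    · exact key i j h

variable (b)

theorem act_lie (x y : L) (p : MvPolynomial I A) :
    act b ⁅x, y⁆ p = act b x (act b y p) - act b y (act b x p) := by
  obtain ⟨n, hn⟩ := exists_mem_degLE p
  exact Eq.symm (actCommutes_of_mem_degLE (fun J _ => actCommutes_monomial J x y) hn)

end Action

/-! ### The representation of the enveloping algebra and its symbol map -/

section Symbol

variable {K A L I : Type u} [CommRing K] [CommRing A] [Algebra K A] [LieRing L] [LieAlgebra K L]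
  [Module A L] [LieRingModule L A] [LieRinehartRing A L] [LieRinehartAlgebra K A L]
  [LinearOrder I] (b : Module.Basis I A L)

variable (K A) in
theorem lie_algebraMap_eq_zero (x : L) (k : K) : ⁅x, algebraMap K A k⁆ = 0 := by
  rw [Algebra.algebraMap_eq_smul_one]
  exact (LieModule.lie_smul k x (1 : A)).trans (by rw [lie_one_eq_zero, smul_zero])

variable (K) in
/-- The representation of `𝒰(A, L)` on `A[X]`. -/
def pbwRep : EnvelopingAlgebra K A L →ₐ[K] Module.End K (MvPolynomial I A) :=
  EnvelopingAlgebra.lift (Algebra.lsmul K K (MvPolynomial I A))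
    { toFun := fun x =>
        { toFun := act b x
          map_add' := map_add _
          map_smul' := fun k p => by
            -- Operators of `L` are not `A`-linear, but they are `K`-linear because the anchor kills
            -- constants; hence endomorphisms are taken over `K`.
            rw [← algebraMap_smul A k p, act_apply_smul, lie_algebraMap_eq_zero, zero_smul,
              add_zero, algebraMap_smul]; rfl }
      map_zero' := by refine LinearMap.ext fun p => ?_; exact act_zero b p
      map_add' := fun x y => by refine LinearMap.ext fun p => ?_; exact act_add b x y p }
    (fun a x => by refine LinearMap.ext fun p => ?_; exact act_smul b a x p)
    (fun x y => by refine LinearMap.ext fun p => ?_; exact act_lie b x y p)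
    (fun x a => by
      refine LinearMap.ext fun p => ?_
      change ⁅x, a⁆ • p = act b x (a • p) - a • act b x p
      rw [act_apply_smul, add_sub_cancel_left])

theorem pbwRep_ιA (a : A) (p : MvPolynomial I A) :
    pbwRep K b (EnvelopingAlgebra.ιA K A L a) p = a • p := by
  rw [pbwRep, EnvelopingAlgebra.lift_ιA]; rfl

theorem pbwRep_ιL (x : L) (p : MvPolynomial I A) :
    pbwRep K b (EnvelopingAlgebra.ιL K A L x) p = act b x p := by
  rw [pbwRep, EnvelopingAlgebra.lift_ιL]; rfl

theorem pbwRep_prod_mem_degLE (l : List L) :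
    pbwRep K b ((l.map (EnvelopingAlgebra.ιL K A L)).prod) 1 ∈ degLE I A l.length := by
  induction l with
  | nil =>
    rw [List.map_nil, List.prod_nil, map_one (pbwRep K b)]
    exact monomial_mem_degLE (map_zero _).le
  | cons x l ih =>
    rw [List.map_cons, List.prod_cons, map_mul, Module.End.mul_apply, pbwRep_ιL]
    exact act_mem_degLE b x ih

variable (K) in
/-- The symbol of degree `n` of an element of `𝒰(A, L)`: the component of degree `n` of its value
on `1 ∈ A[X]`. -/
def pbwSymbol (n : ℕ) : EnvelopingAlgebra K A L →+ MvPolynomial I A where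
  toFun u := homogeneousComponent n (pbwRep K b u 1)
  map_zero' := by simp
  map_add' u v := by simp

/-- Replacing the action of each factor by multiplication with its linear form costs only terms of
lower total degree. -/
theorem pbwSymbol_ιA_mul_prod (a : A) (l : List L) :
    pbwSymbol K b l.length (EnvelopingAlgebra.ιA K A L a *
      (l.map (EnvelopingAlgebra.ιL K A L)).prod) = C a * (l.map (linForm b)).prod := by
  change homogeneousComponent _ (pbwRep K b _ 1) = _
  rw [map_mul, Module.End.mul_apply, pbwRep_ιA, map_smul, ← C_mul']
  congr 1
  induction l with
  | nil => simp
  | cons x l ih =>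
    rw [List.map_cons, List.prod_cons, map_mul, Module.End.mul_apply, pbwRep_ιL, List.map_cons,
      List.prod_cons, List.length_cons, ← ih, ← homogeneousComponent_linForm_mul, ← sub_eq_zero,
      ← map_sub]
    exact homogeneousComponent_eq_zero_of_mem_degLE (Nat.lt_succ_self _)
      (act_sub_mem_degLE b x (pbwRep_prod_mem_degLE b l))

/-- A product of at most `m` vectors moves `1` into degree at most `m`. Thus the degree-`n` symbol
factors through the graded piece of degree `n`. -/
theorem pbwSymbol_eq_zero {m n : ℕ} (hmn : m < n) {u : EnvelopingAlgebra K A L}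
    (hu : u ∈ EnvelopingAlgebra.filtrationStep K A L m) : pbwSymbol K b n u = 0 := by
  induction hu using AddSubgroup.closure_induction with
  | mem u hu =>
    obtain ⟨a, l, hl, rfl⟩ := hu
    change homogeneousComponent _ (pbwRep K b _ 1) = _
    rw [map_mul, Module.End.mul_apply, pbwRep_ιA, map_smul,
      homogeneousComponent_eq_zero_of_mem_degLE (hl.trans_lt hmn) (pbwRep_prod_mem_degLE b l),
      smul_zero]
  | zero => exact map_zero _
  | add u v _ _ hu hv => rw [map_add, hu, hv, add_zero]
  | neg u _ hu => rw [map_neg, hu, neg_zero]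

end Symbol

end LieRinehartAlgebra

/-! ### Stalks of a Lie algebroid -/

namespace LieRinehartAlgebra.Hom

variable {K A L A' L' : Type u} [CommRing K] [CommRing A] [Algebra K A] [LieRing L]
  [LieAlgebra K L] [Module A L] [LieRingModule L A] [CommRing A'] [Algebra K A'] [LieRing L']
  [LieAlgebra K L'] [Module A' L'] [LieRingModule L' A'] {σ : A →ₐ[K] A'}

theorem map_linearCombination (f : LieRinehartAlgebra.Hom σ L L') {I : Type u} (v : I → L)
    (l : I →₀ A) : f (Finsupp.linearCombination A v l) =
      Finsupp.linearCombination A' (fun i => f (v i)) (l.mapRange σ (map_zero σ)) := by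
  induction l using Finsupp.induction_linear with
  | zero => simp
  | add l m hl hm =>
    rw [_root_.map_add, _root_.map_add f.toLieHom, hl, hm, Finsupp.mapRange_add (_root_.map_add σ),
      _root_.map_add]
  | single i a => simp [f.map_smul_apply]

theorem map_mem_span (f : LieRinehartAlgebra.Hom σ L L') {I : Type u} {v : I → L} {x : L}
    (hx : x ∈ Submodule.span A (Set.range v)) :
    f x ∈ Submodule.span A' (Set.range fun i => f (v i)) := by
  obtain ⟨l, rfl⟩ := (Finsupp.mem_span_range_iff_exists_finsupp (R := A)).1 hx
  have h := f.map_linearCombination v l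
  rw [Finsupp.linearCombination_apply] at h
  rw [h]
  exact (Finsupp.mem_span_range_iff_exists_finsupp (R := A')).2 ⟨_, rfl⟩

end LieRinehartAlgebra.Hom

namespace LieAlgebroid

variable {K : Type u} [Field K] {X : TopCat.{u}} {O : TopCat.Sheaf (CommAlgCat.{u} K) X}

/-- The open neighbourhoods of `x`, ordered by reverse inclusion. -/
abbrev Nhd (x : X) : Type u := {V : Opens X // x ∈ V}ᵒᵈ

namespace Nhd

variable {x : X}

/-- The underlying open set. -/
def opens (V : Nhd x) : Opens X := (OrderDual.ofDual V).1

theorem mem (V : Nhd x) : x ∈ V.opens := (OrderDual.ofDual V).2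

/-- An open set containing `x` as a neighbourhood of `x`. -/
def mk (V : Opens X) (hV : x ∈ V) : Nhd x := OrderDual.toDual ⟨V, hV⟩

/-- The inclusion of a smaller neighbourhood. -/
def incl {V W : Nhd x} (h : V ≤ W) : W.opens ⟶ V.opens := homOfLE h

instance : Nonempty (Nhd x) := ⟨mk ⊤ trivial⟩

instance : IsDirectedOrder (Nhd x) where
  directed V W := ⟨mk (V.opens ⊓ W.opens) ⟨V.mem, W.mem⟩,
    (inf_le_left : V.opens ⊓ W.opens ≤ V.opens), (inf_le_right : V.opens ⊓ W.opens ≤ W.opens)⟩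

end Nhd

variable (O) in
/-- The restriction `O(V) → O(W)`. -/
def resO {x : X} (V W : Nhd x) (h : V ≤ W) :
    O.presheaf.obj (op V.opens) →ₐ[K] O.presheaf.obj (op W.opens) :=
  (O.presheaf.map (Nhd.incl h).op).hom

instance (x : X) : DirectedSystem (fun V : Nhd x => O.presheaf.obj (op V.opens))
    (fun V W h => resO O V W h) where
  map_self V s := by
    change (O.presheaf.map (𝟙 _)).hom s = s
    rw [O.presheaf.map_id]; rfl
  map_map W V U h h' s := by
    change _ = (O.presheaf.map ((Nhd.incl h).op ≫ (Nhd.incl h').op)).hom s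
    rw [O.presheaf.map_comp]; rfl

variable (O) in
/-- The stalk of `O` at `x`. -/
abbrev StalkO (x : X) : Type u :=
  DirectLimit (fun V : Nhd x => O.presheaf.obj (op V.opens)) (resO O)

variable (L : LieAlgebroid O)

/-- The restriction `L(V) → L(W)`. -/
def resL {x : X} (V W : Nhd x) (h : V ≤ W) :
    L.obj (op V.opens) →ₗ⁅K⁆ L.obj (op W.opens) :=
  (L.res (Nhd.incl h).op).toLieHom

instance (x : X) : DirectedSystem (fun V : Nhd x => L.obj (op V.opens))
    (fun V W h => L.resL V W h) where
  map_self _ s := L.res_id _ s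
  map_map _ _ _ _ _ s := (L.res_comp _ _ s).symm

/-- The stalk of `L` at `x`. -/
abbrev Stalk (x : X) : Type u :=
  DirectLimit (fun V : Nhd x => L.obj (op V.opens)) L.resL

variable {x : X}

/-- The germ at `x` of a function. -/
def germO (V : Nhd x) : O.presheaf.obj (op V.opens) →ₐ[K] StalkO O x :=
  DirectLimit.Algebra.of (fun V : Nhd x => O.presheaf.obj (op V.opens)) (resO O) V

theorem germO_res {V W : Nhd x} (h : V ≤ W) (s : O.presheaf.obj (op V.opens)) :
    germO W (resO O V W h s) = germO V s :=
  Eq.symm (Quotient.sound (DirectLimit.r_of_le (resO O) ⟨V, s⟩ W h))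

theorem exists_germO (V₀ : Nhd x) (a : StalkO O x) :
    ∃ (V : Nhd x) (_ : V₀ ≤ V) (s : _), a = germO V s := by
  obtain ⟨V, s, rfl⟩ := DirectLimit.exists_eq_mk (resO O) a
  obtain ⟨W, hV, hW⟩ := exists_ge_ge V V₀
  exact ⟨W, hW, resO O V W hV s, (germO_res hV s).symm⟩

theorem germO_eq {V : Nhd x} {s t : O.presheaf.obj (op V.opens)} (h : germO V s = germO V t) :
    ∃ (W : Nhd x) (h : V ≤ W), resO O V W h s = resO O V W h t := by
  obtain ⟨W, h1, h2, e⟩ := Quotient.exact h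
  exact ⟨W, h1, e⟩

/-- The germ at `x` of a section of `L`. -/
def germFun (V : Nhd x) : L.obj (op V.opens) →ₗ[K] L.Stalk x :=
  DirectLimit.Module.of K (Nhd x) (fun V : Nhd x => L.obj (op V.opens)) L.resL V

theorem germFun_res {V W : Nhd x} (h : V ≤ W) (s : L.obj (op V.opens)) :
    L.germFun W (L.resL V W h s) = L.germFun V s :=
  Eq.symm (Quotient.sound (DirectLimit.r_of_le L.resL ⟨V, s⟩ W h))

theorem exists_germFun (V₀ : Nhd x) (a : L.Stalk x) :
    ∃ (V : Nhd x) (_ : V₀ ≤ V) (s : _), a = L.germFun V s := by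
  obtain ⟨V, s, rfl⟩ := DirectLimit.exists_eq_mk L.resL a
  obtain ⟨W, hV, hW⟩ := exists_ge_ge V V₀
  exact ⟨W, hW, L.resL V W hV s, (L.germFun_res hV s).symm⟩

theorem germFun_eq {V : Nhd x} {s t : L.obj (op V.opens)} (h : L.germFun V s = L.germFun V t) :
    ∃ (W : Nhd x) (h : V ≤ W), L.resL V W h s = L.resL V W h t := by
  obtain ⟨W, h1, h2, e⟩ := Quotient.exact h
  exact ⟨W, h1, e⟩

instance : Bracket (L.Stalk x) (L.Stalk x) where
  bracket := DirectLimit.map₂ L.resL L.resL L.resL (fun _ s t => ⁅s, t⁆)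
    (fun V W h s t => LieHom.map_lie (L.resL V W h) s t)

instance : SMul (StalkO O x) (L.Stalk x) where
  smul := DirectLimit.map₂ (resO O) L.resL L.resL (fun _ s t => s • t)
    (fun _ _ h s t => (L.res (Nhd.incl h).op).map_smul_apply s t)

instance : Bracket (L.Stalk x) (StalkO O x) where
  bracket := DirectLimit.map₂ L.resL (resO O) (resO O) (fun _ s t => ⁅s, t⁆)
    (fun _ _ h s t => (L.res (Nhd.incl h).op).apply_lie t s)

theorem germFun_lie (V : Nhd x) (s t : L.obj (op V.opens)) :
    ⁅L.germFun V s, L.germFun V t⁆ = L.germFun V ⁅s, t⁆ :=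
  DirectLimit.map₂_def ..

theorem germO_smul (V : Nhd x) (s : O.presheaf.obj (op V.opens)) (t : L.obj (op V.opens)) :
    germO V s • L.germFun V t = L.germFun V (s • t) :=
  DirectLimit.map₂_def ..

theorem germFun_lie_germO (V : Nhd x) (s : L.obj (op V.opens)) (t : O.presheaf.obj (op V.opens)) :
    ⁅L.germFun V s, germO V t⁆ = germO V ⁅s, t⁆ :=
  DirectLimit.map₂_def ..

@[elab_as_elim]
theorem germFun_induction {motive : L.Stalk x → Prop} (s : L.Stalk x)
    (h : ∀ V s, motive (L.germFun V s)) : motive s := by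
  obtain ⟨V, -, s, rfl⟩ := L.exists_germFun (Classical.arbitrary _) s
  exact h V s

-- Finitely many germs have representatives over one common neighbourhood. This principle and its
-- variants reduce each identity on stalks to the same identity for sections.
@[elab_as_elim]
theorem germFun_induction₂ {motive : L.Stalk x → L.Stalk x → Prop} (s t : L.Stalk x)
    (h : ∀ V s t, motive (L.germFun V s) (L.germFun V t)) : motive s t := by
  obtain ⟨V, -, s, rfl⟩ := L.exists_germFun (Classical.arbitrary _) s
  obtain ⟨W, hV, t, rfl⟩ := L.exists_germFun V t
  rw [← L.germFun_res hV]
  exact h W _ _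

@[elab_as_elim]
theorem germFun_induction₃ {motive : L.Stalk x → L.Stalk x → L.Stalk x → Prop} (s t r : L.Stalk x)
    (h : ∀ V s t r, motive (L.germFun V s) (L.germFun V t) (L.germFun V r)) : motive s t r := by
  revert r
  refine L.germFun_induction₂ s t fun V s t r => ?_
  obtain ⟨W, hV, r, rfl⟩ := L.exists_germFun V r
  rw [← L.germFun_res hV, ← L.germFun_res hV]
  exact h W _ _ _

@[elab_as_elim]
theorem germ_induction_fun₂_O {motive : L.Stalk x → L.Stalk x → StalkO O x → Prop}
    (s t : L.Stalk x) (a : StalkO O x)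
    (h : ∀ V s t a, motive (L.germFun V s) (L.germFun V t) (germO V a)) : motive s t a := by
  revert a
  refine L.germFun_induction₂ s t fun V s t a => ?_
  obtain ⟨W, hV, a, rfl⟩ := exists_germO V a
  rw [← L.germFun_res hV, ← L.germFun_res hV]
  exact h W _ _ _

@[elab_as_elim]
theorem germ_induction_fun_O₂ {motive : L.Stalk x → StalkO O x → StalkO O x → Prop}
    (s : L.Stalk x) (a b : StalkO O x)
    (h : ∀ V s a b, motive (L.germFun V s) (germO V a) (germO V b)) : motive s a b := by
  obtain ⟨U, -, s, rfl⟩ := L.exists_germFun (Classical.arbitrary _) s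
  obtain ⟨V, hU, a, rfl⟩ := exists_germO U a
  obtain ⟨W, hV, b, rfl⟩ := exists_germO V b
  rw [← germO_res hV, ← L.germFun_res (hU.trans hV)]
  exact h W _ _ _

instance : LieRing (L.Stalk x) where
  add_lie s t r := L.germFun_induction₃ s t r fun V s t r => by
    simp only [← map_add, germFun_lie, add_lie]
  lie_add s t r := L.germFun_induction₃ s t r fun V s t r => by
    simp only [← map_add, germFun_lie, lie_add]
  lie_self s := L.germFun_induction s fun V s => by
    rw [germFun_lie, lie_self, map_zero]
  leibniz_lie s t r := L.germFun_induction₃ s t r fun V s t r => by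
    simp only [germFun_lie, ← map_add, leibniz_lie s t r]

instance : LieAlgebra K (L.Stalk x) where
  lie_smul k s t := L.germFun_induction₂ s t fun V s t => by
    simp only [← map_smul, germFun_lie, lie_smul]

instance : Module (StalkO O x) (L.Stalk x) where
  one_smul s := L.germFun_induction s fun V s => by
    rw [← map_one (germO V), germO_smul, one_smul]
  mul_smul a b s := L.germ_induction_fun_O₂ s a b fun V s a b => by
    simp only [← map_mul, germO_smul, mul_smul]
  smul_zero a := by
    -- Only the scalar germ matters here; the other two slots are dummies.
    refine L.germ_induction_fun_O₂ (motive := fun _ a _ => a • (0 : L.Stalk x) = 0) 0 a a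
      fun V s a b => ?_
    rw [← map_zero (L.germFun V), germO_smul, smul_zero]
  smul_add a s t := L.germ_induction_fun₂_O s t a fun V s t a => by
    simp only [← map_add, germO_smul, smul_add]
  add_smul a b s := L.germ_induction_fun_O₂ s a b fun V s a b => by
    simp only [← map_add, germO_smul, add_smul]
  zero_smul s := L.germFun_induction s fun V s => by
    rw [← map_zero (germO V), germO_smul, zero_smul, map_zero]

instance : LieRingModule (L.Stalk x) (StalkO O x) where
  add_lie s t a := L.germ_induction_fun₂_O s t a fun V s t a => by
    simp only [← map_add, germFun_lie_germO, add_lie]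
  lie_add s a b := L.germ_induction_fun_O₂ s a b fun V s a b => by
    simp only [← map_add, germFun_lie_germO, lie_add]
  leibniz_lie s t a := L.germ_induction_fun₂_O s t a fun V s t a => by
    simp only [germFun_lie_germO, germFun_lie, ← map_add, leibniz_lie s t a]

instance : LieRinehartRing (StalkO O x) (L.Stalk x) where
  lie_smul_eq_mul' a b s := L.germ_induction_fun_O₂ s a b fun V s a b => by
    simp only [germO_smul, germFun_lie_germO, ← map_mul, LieRinehartRing.lie_smul_eq_mul]
  leibniz_mul_right' s a b := L.germ_induction_fun_O₂ s a b fun V s a b => by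
    simp only [smul_eq_mul, germFun_lie_germO, ← map_mul, ← map_add,
      LieRinehartRing.leibniz_mul_right]
  leibniz_smul_right' s t a := L.germ_induction_fun₂_O s t a fun V s t a => by
    simp only [germO_smul, germFun_lie_germO, germFun_lie, ← map_add,
      LieRinehartRing.leibniz_smul_right]

instance : LieRinehartAlgebra K (StalkO O x) (L.Stalk x) where
  smul_assoc k a s := L.germ_induction_fun_O₂ s a a fun V s a _ => by
    simp only [← map_smul, germO_smul, smul_assoc]
  smul_lie k s a := L.germ_induction_fun_O₂ s a a fun V s a _ => by
    simp only [← map_smul, germFun_lie_germO, smul_lie]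
  lie_smul k s a := L.germ_induction_fun_O₂ s a a fun V s _ a => by
    simp only [← map_smul, germFun_lie_germO]
    exact congrArg _ (LieModule.lie_smul k s a)

/-- The germ at `x` as a morphism of Lie–Rinehart algebras. -/
def germ (V : Nhd x) :
    LieRinehartAlgebra.Hom (germO (O := O) V) (L.obj (op V.opens)) (L.Stalk x) where
  __ := L.germFun V
  map_lie' := (L.germFun_lie V _ _).symm
  map_smul_apply' a s := (L.germO_smul V a s).symm
  apply_lie' a s := (L.germFun_lie_germO V s a).symm

theorem germ_res {V W : Nhd x} (h : V ≤ W) (s : L.obj (op V.opens)) :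
    L.germ W (L.res (Nhd.incl h).op s) = L.germ V s :=
  L.germFun_res h s

/-- Only finitely many coefficients are nonzero, so one neighbourhood represents them all. -/
theorem exists_lift_finsupp {I : Type u} (V₀ : Nhd x) (l : I →₀ StalkO O x) :
    ∃ (V : Nhd x) (_ : V₀ ≤ V) (m : I →₀ O.presheaf.obj (op V.opens)),
      l = m.mapRange (germO V) (map_zero _) := by
  induction l using Finsupp.induction_linear with
  | zero => exact ⟨V₀, le_rfl, 0, by simp⟩
  | add l l' h h' =>
    obtain ⟨V, hV, m, rfl⟩ := h
    obtain ⟨V', hV', m', rfl⟩ := h'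
    obtain ⟨W, h, h'⟩ := exists_ge_ge V V'
    refine ⟨W, hV.trans h, m.mapRange (resO O V W h) (map_zero _) +
      m'.mapRange (resO O V' W h') (map_zero _), ?_⟩
    ext k
    simp [germO_res]
  | single k a =>
    obtain ⟨V, hV, s, rfl⟩ := exists_germO V₀ a
    exact ⟨V, hV, Finsupp.single k s, by simp⟩

/-- A family of sections over `U` is a local basis of `L` if the induced morphism
`O^{⊕I}|_U → L|_U` is an isomorphism. -/
def IsLocalBasis {U : Opens X} {I : Type u} (e : I → L.obj (op U)) : Prop :=
  ∀ (V : Opens X) (i : V ⟶ U),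
    LinearIndependent (O.presheaf.obj (op V)) (fun k => L.res i.op (e k)) ∧
    ∀ (s : L.obj (op V)), ∀ y ∈ V, ∃ (W : Opens X) (_ : y ∈ W) (j : W ⟶ V),
      L.res j.op s ∈ Submodule.span (O.presheaf.obj (op W))
        (Set.range fun k => L.res (j ≫ i).op (e k))

variable {L} {V : Nhd x} {I : Type u} {e : I → L.obj (op V.opens)}

/-- A relation between germs has finitely many coefficients and already holds between sections on
some neighbourhood. The basis sections are independent there, so the coefficients vanish on it and
their germs are zero. -/
theorem IsLocalBasis.linearIndependent_germ (he : L.IsLocalBasis e) :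
    LinearIndependent (StalkO O x) (fun k => L.germ V (e k)) := by
  rw [linearIndependent_iff]
  intro l hl
  obtain ⟨W, hW, m, rfl⟩ := exists_lift_finsupp V l
  have h1 : L.germFun W (Finsupp.linearCombination _ (fun k => L.res (Nhd.incl hW).op (e k)) m) =
      L.germFun W 0 := by
    rw [map_zero, ← hl]
    refine ((L.germ W).map_linearCombination _ m).trans ?_
    congr 2
    funext k
    exact L.germ_res hW (e k)
  obtain ⟨W', hW', h2⟩ := L.germFun_eq h1
  rw [map_zero] at h2
  have h3 := ((L.res (Nhd.incl hW').op).map_linearCombination _ m).symm.trans h2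
  have h4 : m.mapRange (resO O W W' hW') (map_zero _) = 0 := by
    refine linearIndependent_iff.1 (he W'.opens (Nhd.incl (hW.trans hW'))).1 _ ?_
    refine Eq.trans ?_ h3
    congr 2
    funext k
    exact L.res_comp (Nhd.incl hW).op (Nhd.incl hW').op (e k)
  ext k
  have h5 := DFunLike.congr_fun h4 k
  simp only [Finsupp.mapRange_apply, Finsupp.zero_apply] at h5 ⊢
  rw [← germO_res hW', h5, map_zero]

theorem IsLocalBasis.span_germ (he : L.IsLocalBasis e) :
    ⊤ ≤ Submodule.span (StalkO O x) (Set.range fun k => L.germ V (e k)) := by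
  intro s _
  obtain ⟨W, hW, s, rfl⟩ := L.exists_germFun V s
  obtain ⟨W', hx, j, h⟩ := (he W.opens (Nhd.incl hW)).2 s x W.mem
  have hWW' : W ≤ Nhd.mk W' hx := j.le
  have h1 := (L.germ (Nhd.mk W' hx)).map_mem_span h
  have h2 : L.germ (Nhd.mk W' hx) (L.res j.op s) = L.germFun W s := L.germFun_res hWW' s
  rw [h2] at h1
  have h3 : (fun k => L.germ V (e k)) = fun k =>
      L.germ (Nhd.mk W' hx) (L.res (j ≫ Nhd.incl hW).op (e k)) :=
    funext fun k => (L.germFun_res (hW.trans hWW') (e k)).symm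
  rw [h3]
  exact h1

/-- The germs of a local basis form a basis of the stalk. -/
def IsLocalBasis.stalkBasis (he : L.IsLocalBasis e) :
    Module.Basis I (StalkO O x) (L.Stalk x) :=
  Module.Basis.mk he.linearIndependent_germ he.span_germ

theorem IsLocalBasis.stalkBasis_apply (he : L.IsLocalBasis e) (k : I) :
    he.stalkBasis k = L.germ V (e k) :=
  Module.Basis.mk_apply ..

end LieAlgebroid

/-! ### Symbols -/

namespace RingFiltration

variable {A : Type u} [Ring A] (Φ : RingFiltration A)

theorem below_mono : Monotone Φ.below := by
  intro m n hmn
  cases m with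
  | zero => exact bot_le
  | succ m =>
    cases n with
    | zero => omega
    | succ n => exact Φ.mono (by omega)

theorem symbol_congr {m n : ℕ} (h : m = n) {a b : A} (hab : a = b) (ha : a ∈ Φ.F m)
    (hb : b ∈ Φ.F n) : Φ.symbol m a ha = Φ.symbol n b hb := by
  subst h; subst hab; rfl

theorem symbol_add {n : ℕ} {a b : A} (ha : a ∈ Φ.F n) (hb : b ∈ Φ.F n) :
    Φ.symbol n (a + b) (add_mem ha hb) = Φ.symbol n a ha + Φ.symbol n b hb := by
  unfold symbol
  rw [← map_add, piece_add]

theorem piece_eq_zero_iff {n : ℕ} {a : A} (ha : a ∈ Φ.F n) :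
    Φ.piece n a ha = 0 ↔ a ∈ Φ.below n := by
  have h := Φ.piece_eq_iff (zero_mem (Φ.F n)) ha
  rw [neg_zero, zero_add] at h
  rw [← h]
  exact eq_comm

theorem symbol_eq_zero {n : ℕ} {a : A} (ha : a ∈ Φ.F n) (h : a ∈ Φ.below n) :
    Φ.symbol n a ha = 0 := by
  unfold symbol
  rw [(Φ.piece_eq_zero_iff ha).2 h, map_zero]

theorem symbol_eq_of_sub_mem_below {n : ℕ} {a b : A} (ha : a ∈ Φ.F n) (hb : b ∈ Φ.F n)
    (h : a - b ∈ Φ.below n) : Φ.symbol n a ha = Φ.symbol n b hb := by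
  unfold symbol
  congr 1
  rw [Φ.piece_eq_iff, ← neg_mem_iff]
  simpa [sub_eq_add_neg, add_comm] using h

theorem gr_induction {motive : Φ.Gr → Prop} (x : Φ.Gr) (zero : motive 0)
    (symbol : ∀ n a ha, motive (Φ.symbol n a ha))
    (add : ∀ x y, motive x → motive y → motive (x + y)) : motive x := by
  induction x using DirectSum.induction_on with
  | zero => exact zero
  | of n y =>
    obtain ⟨a, ha, rfl⟩ := Φ.exists_piece y
    exact symbol n a ha
  | add x y hx hy => exact add x y hx hy

/-- The associated graded ring is commutative if commutators drop the degree. -/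
theorem gr_mul_comm (h : ∀ {m n : ℕ} {a b : A}, a ∈ Φ.F m → b ∈ Φ.F n →
    a * b - b * a ∈ Φ.below (m + n)) (x y : Φ.Gr) : x * y = y * x := by
  induction x using Φ.gr_induction with
  | zero => simp
  | add x x' hx hx' => rw [add_mul, mul_add, hx, hx']
  | symbol m a ha =>
    induction y using Φ.gr_induction with
    | zero => simp
    | add y y' hy hy' => rw [add_mul, mul_add, hy, hy']
    | symbol n b hb =>
      rw [symbol_mul, symbol_mul, Φ.symbol_congr (add_comm n m) rfl (Φ.mul_mem hb ha)
        (add_comm n m ▸ Φ.mul_mem hb ha)]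
      exact Φ.symbol_eq_of_sub_mem_below _ _ (h ha hb)

end RingFiltration

/-! ### Commutators in the enveloping algebra -/

namespace EnvelopingAlgebra

variable (K A L : Type u) [CommRing K] [CommRing A] [Algebra K A] [LieRing L] [Module A L]
  [LieRingModule L A]

/-- The canonical filtration of `𝒰(A, L)`. -/
def filtration : RingFiltration (EnvelopingAlgebra K A L) where
  F := filtrationStep K A L
  mono := filtrationStep_mono
  one_mem := by simpa using ιA_mem (K := K) (L := L) (1 : A)
  mul_mem := filtrationStep_mul_mem

variable {K A L}

theorem prod_mem (l : List L) :
    (l.map (ιL K A L)).prod ∈ (filtration K A L).F l.length :=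
  AddSubgroup.subset_closure ⟨1, l, le_rfl, by simp⟩

/-- Each exchange of `a` with a vector replaces that vector by the function `⁅x, a⁆`, losing one
factor. -/
theorem commutator_ιA_prod (a : A) (l : List L) :
    ιA K A L a * (l.map (ιL K A L)).prod - (l.map (ιL K A L)).prod * ιA K A L a ∈
      (filtration K A L).below l.length := by
  induction l with
  | nil => simp
  | cons x l ih =>
    have e : ιA K A L a * ((x :: l).map (ιL K A L)).prod -
        ((x :: l).map (ιL K A L)).prod * ιA K A L a =
        ιL K A L x * (ιA K A L a * (l.map (ιL K A L)).prod -
          (l.map (ιL K A L)).prod * ιA K A L a) -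
            ιA K A L ⁅x, a⁆ * (l.map (ιL K A L)).prod := by
      rw [ιA_lie, List.map_cons, List.prod_cons]; noncomm_ring
    rw [e, List.length_cons, add_comm]
    refine sub_mem ((filtration K A L).mul_below_mem (ιL_mem x) ih) ?_
    rw [add_comm]
    exact ιA_mul_mem _ (prod_mem l)

/-- Each exchange of two vectors replaces them by one, their bracket. The bound is one less than the
number of factors involved, since `F k` is `below (k + 1)`. -/
theorem commutator_ιL_prod (x : L) (l : List L) :
    ιL K A L x * (l.map (ιL K A L)).prod - (l.map (ιL K A L)).prod * ιL K A L x ∈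
      (filtration K A L).F l.length := by
  induction l with
  | nil => simp
  | cons y l ih =>
    have e : ιL K A L x * ((y :: l).map (ιL K A L)).prod -
        ((y :: l).map (ιL K A L)).prod * ιL K A L x =
        ιL K A L y * (ιL K A L x * (l.map (ιL K A L)).prod -
          (l.map (ιL K A L)).prod * ιL K A L x) +
            ιL K A L ⁅x, y⁆ * (l.map (ιL K A L)).prod := by
      rw [ιL_lie, List.map_cons, List.prod_cons]; noncomm_ring
    rw [e, List.length_cons]
    exact add_mem (ιL_mul_mem y ih) (ιL_mul_mem _ (prod_mem l))

theorem commutator_ιA {n : ℕ} (a : A) {v : EnvelopingAlgebra K A L}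
    (hv : v ∈ (filtration K A L).F n) :
    ιA K A L a * v - v * ιA K A L a ∈ (filtration K A L).below n := by
  induction hv using AddSubgroup.closure_induction with
  | mem v hv =>
    obtain ⟨c, l, hl, rfl⟩ := hv
    have e : ιA K A L a * (ιA K A L c * (l.map (ιL K A L)).prod) -
        ιA K A L c * (l.map (ιL K A L)).prod * ιA K A L a =
        ιA K A L c * (ιA K A L a * (l.map (ιL K A L)).prod -
          (l.map (ιL K A L)).prod * ιA K A L a) := by
      rw [← mul_assoc, ← map_mul, mul_comm a c, map_mul]; noncomm_ring
    rw [e, ← zero_add n]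
    exact (filtration K A L).mul_below_mem (ιA_mem c)
      ((filtration K A L).below_mono hl (commutator_ιA_prod a l))
  | zero => simp
  | add u v _ _ hu hv =>
    rw [mul_add, add_mul, add_sub_add_comm]; exact add_mem hu hv
  | neg u _ hu =>
    rw [mul_neg, neg_mul, ← neg_sub_neg, neg_neg, neg_neg, ← neg_sub]; exact neg_mem hu

theorem commutator_ιL {n : ℕ} (x : L) {v : EnvelopingAlgebra K A L}
    (hv : v ∈ (filtration K A L).F n) :
    ιL K A L x * v - v * ιL K A L x ∈ (filtration K A L).F n := by
  induction hv using AddSubgroup.closure_induction with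
  | mem v hv =>
    obtain ⟨c, l, hl, rfl⟩ := hv
    have e : ιL K A L x * (ιA K A L c * (l.map (ιL K A L)).prod) -
        ιA K A L c * (l.map (ιL K A L)).prod * ιL K A L x =
        ιA K A L c * (ιL K A L x * (l.map (ιL K A L)).prod -
          (l.map (ιL K A L)).prod * ιL K A L x) +
            ιA K A L ⁅x, c⁆ * (l.map (ιL K A L)).prod := by
      rw [ιA_lie]; noncomm_ring
    rw [e]
    exact filtrationStep_mono hl (add_mem (ιA_mul_mem c (commutator_ιL_prod x l))
      (ιA_mul_mem _ (prod_mem l)))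
  | zero => simp
  | add u v _ _ hu hv =>
    rw [mul_add, add_mul, add_sub_add_comm]; exact add_mem hu hv
  | neg u _ hu =>
    rw [mul_neg, neg_mul, ← neg_sub_neg, neg_neg, neg_neg, ← neg_sub]; exact neg_mem hu

theorem commutator_prod {n : ℕ} (l : List L) {v : EnvelopingAlgebra K A L}
    (hv : v ∈ (filtration K A L).F n) :
    (l.map (ιL K A L)).prod * v - v * (l.map (ιL K A L)).prod ∈
      (filtration K A L).below (l.length + n) := by
  induction l with
  | nil => simp
  | cons x l ih =>
    have e : ((x :: l).map (ιL K A L)).prod * v - v * ((x :: l).map (ιL K A L)).prod =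
        ιL K A L x * ((l.map (ιL K A L)).prod * v - v * (l.map (ιL K A L)).prod) +
          (ιL K A L x * v - v * ιL K A L x) * (l.map (ιL K A L)).prod := by
      rw [List.map_cons, List.prod_cons]; noncomm_ring
    rw [e, List.length_cons]
    refine add_mem ?_ ?_
    · rw [add_comm l.length 1, add_assoc]
      exact (filtration K A L).mul_below_mem (ιL_mem x) ih
    · rw [show l.length + 1 + n = n + l.length + 1 by omega]
      exact (filtration K A L).mul_mem (commutator_ιL x hv) (prod_mem l)

/-- The commutator with `v` is a derivation, so a generator `c x₁ ⋯ xₘ` reduces to its function and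
its vectors. -/
theorem commutator_mem {m n : ℕ} {u v : EnvelopingAlgebra K A L}
    (hu : u ∈ (filtration K A L).F m) (hv : v ∈ (filtration K A L).F n) :
    u * v - v * u ∈ (filtration K A L).below (m + n) := by
  induction hu using AddSubgroup.closure_induction with
  | mem u hu =>
    obtain ⟨c, l, hl, rfl⟩ := hu
    have e : ιA K A L c * (l.map (ιL K A L)).prod * v - v * (ιA K A L c * (l.map (ιL K A L)).prod) =
        ιA K A L c * ((l.map (ιL K A L)).prod * v - v * (l.map (ιL K A L)).prod) +
          (ιA K A L c * v - v * ιA K A L c) * (l.map (ιL K A L)).prod := by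
      noncomm_ring
    rw [e]
    refine (filtration K A L).below_mono (Nat.add_le_add_right hl n) (add_mem ?_ ?_)
    · rw [← zero_add (l.length + n)]
      exact (filtration K A L).mul_below_mem (ιA_mem c) (commutator_prod l hv)
    · rw [add_comm]
      exact (filtration K A L).below_mul_mem (commutator_ιA c hv) (prod_mem l)
  | zero => simp
  | add u u' _ _ hu hu' =>
    rw [mul_add, add_mul, add_sub_add_comm]; exact add_mem hu hu'
  | neg u _ hu =>
    rw [mul_neg, neg_mul, ← neg_sub_neg, neg_neg, neg_neg, ← neg_sub]; exact neg_mem hu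

end EnvelopingAlgebra

/-! ### Ring homomorphisms from a symmetric algebra -/

namespace SymmetricAlgebra

variable {A M : Type u} [CommRing A] [AddCommGroup M] [Module A M]

/-- The ring homomorphism from the symmetric algebra to a ring with commutative multiplication given
by a ring homomorphism on scalars and a compatible additive map on the module. -/
def liftRing {R : Type u} [Ring R] (hR : ∀ a b : R, a * b = b * a) (φ : A →+* R) (ψ : M →+ R)
    (h : ∀ a x, ψ (a • x) = φ a * ψ x) : SymmetricAlgebra A M →+* R :=
  -- The commutative structure extends the given one, so the resulting homomorphism is for the
  -- original ring operations.
  letI : CommRing R := { ‹Ring R› with mul_comm := hR }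
  letI : Algebra A R := φ.toAlgebra
  (SymmetricAlgebra.lift ({ toFun := ψ, map_add' := map_add ψ, map_smul' := h } :
    M →ₗ[A] R)).toRingHom

section

variable {R : Type u} [Ring R] (hR : ∀ a b : R, a * b = b * a) (φ : A →+* R) (ψ : M →+ R)
    (h : ∀ a x, ψ (a • x) = φ a * ψ x)

theorem liftRing_algebraMap (a : A) :
    liftRing hR φ ψ h (algebraMap A (SymmetricAlgebra A M) a) = φ a :=
  letI : CommRing R := { ‹Ring R› with mul_comm := hR }
  letI : Algebra A R := φ.toAlgebra
  AlgHom.commutes (SymmetricAlgebra.lift _) a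

theorem liftRing_ι (x : M) : liftRing hR φ ψ h (SymmetricAlgebra.ι A M x) = ψ x :=
  letI : CommRing R := { ‹Ring R› with mul_comm := hR }
  letI : Algebra A R := φ.toAlgebra
  SymmetricAlgebra.lift_ι_apply _ x

end

/-- The symmetric algebra is additively generated by the products `a x₁ ⋯ xₙ`. -/
theorem closure_products_eq_top :
    AddSubgroup.closure {p : SymmetricAlgebra A M | ∃ (a : A) (l : List M),
      p = algebraMap A _ a * (l.map (SymmetricAlgebra.ι A M)).prod} = ⊤ := by
  rw [AddSubgroup.eq_top_iff']
  intro p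
  induction p using SymmetricAlgebra.induction with
  | algebraMap r => exact AddSubgroup.subset_closure ⟨r, [], by simp⟩
  | ι x => exact AddSubgroup.subset_closure ⟨1, [x], by simp⟩
  | add p q hp hq => exact add_mem hp hq
  | mul p q hp hq =>
    induction hp using AddSubgroup.closure_induction with
    | zero => rw [zero_mul]; exact zero_mem _
    | add p p' _ _ hp hp' => rw [add_mul]; exact add_mem hp hp'
    | neg p _ hp => rw [neg_mul]; exact neg_mem hp
    | mem p hp =>
      obtain ⟨a, l, rfl⟩ := hp
      induction hq using AddSubgroup.closure_induction with
      | zero => rw [mul_zero]; exact zero_mem _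
      | add p p' _ _ hp hp' => rw [mul_add]; exact add_mem hp hp'
      | neg p _ hp => rw [mul_neg]; exact neg_mem hp
      | mem q hq =>
        obtain ⟨c, l', rfl⟩ := hq
        refine AddSubgroup.subset_closure ⟨a * c, l ++ l', ?_⟩
        rw [map_mul, List.map_append, List.prod_append, mul_mul_mul_comm]

end SymmetricAlgebra

/-! ### The morphism from the symmetric algebra to the associated graded algebra -/

namespace LieAlgebroid

variable {K : Type u} [Field K] {X : TopCat.{u}} {O : TopCat.Sheaf (CommAlgCat.{u} K) X}
  (L : LieAlgebroid O)

/-- The canonical filtration of `𝒰(O(U), L(U))`. -/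
abbrev sectionFiltration (U : Opens X) :
    RingFiltration (EnvelopingAlgebra K (O.presheaf.obj (op U)) (L.obj (op U))) :=
  EnvelopingAlgebra.filtration K (O.presheaf.obj (op U)) (L.obj (op U))

theorem toEnvSheaf_mem {n : ℕ} {U : Opens X}
    {t : EnvelopingAlgebra K (O.presheaf.obj (op U)) (L.obj (op U))}
    (ht : t ∈ (L.sectionFiltration U).F n) : L.toEnvSheaf U t ∈ (L.envFiltration U).F n :=
  L.inFiltration_toEnvSheaf ht

/-- For positive `n` this is the definition of the sheafified filtration. For `n = 0`, where `below`
is zero, it is the fact that a locally zero section of a sheaf is zero. -/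
theorem mem_below_of_locally {n : ℕ} {U : Opens X} {s : L.envSheaf.presheaf.obj (op U)}
    (h : ∀ x ∈ U, ∃ (V : Opens X) (_ : x ∈ V) (i : V ⟶ U),
      ∃ t ∈ (L.sectionFiltration V).below n,
        (L.envSheaf.presheaf.map i.op).hom s = L.toEnvSheaf V t) :
    s ∈ (L.envFiltration U).below n := by
  cases n with
  | succ n => exact h
  | zero =>
    change s = 0
    choose V hV i t ht e using h
    refine L.envSheaf.eq_of_locally_eq' (fun x : U => V x.1 x.2) U (fun x => i x.1 x.2)
      (fun x hx => Opens.mem_iSup.2 ⟨⟨x, hx⟩, hV x hx⟩) s 0 fun x => ?_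
    have h0 : t x.1 x.2 = 0 := ht x.1 x.2
    refine (e x.1 x.2).trans ?_
    rw [h0, map_zero]
    exact (map_zero (L.envSheaf.presheaf.map (i x.1 x.2).op).hom).symm

theorem exists_below_of_mem_below {n : ℕ} {U : Opens X} {s : L.envSheaf.presheaf.obj (op U)}
    (h : s ∈ (L.envFiltration U).below n) {x : X} (hx : x ∈ U) :
    ∃ (V : Opens X) (_ : x ∈ V) (i : V ⟶ U), ∃ t ∈ (L.sectionFiltration V).below n,
        (L.envSheaf.presheaf.map i.op).hom s = L.toEnvSheaf V t := by
  cases n with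
  | succ n => exact h x hx
  | zero =>
    have h0 : s = 0 := h
    refine ⟨U, hx, 𝟙 U, 0, rfl, ?_⟩
    rw [h0, map_zero, map_zero]

theorem commutator_mem_below {m n : ℕ} {U : Opens X} {s t : L.envSheaf.presheaf.obj (op U)}
    (hs : s ∈ (L.envFiltration U).F m) (ht : t ∈ (L.envFiltration U).F n) :
    s * t - t * s ∈ (L.envFiltration U).below (m + n) := by
  refine L.mem_below_of_locally fun x hx => ?_
  obtain ⟨V, hxV, i, s', hs', e⟩ := hs x hx
  obtain ⟨W, hxW, j, t', ht', e'⟩ := InFiltration.res ht i x hxV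
  refine ⟨W, hxW, j ≫ i, _, EnvelopingAlgebra.commutator_mem
    (EnvelopingAlgebra.map_mem (L.res j.op) hs') ht', ?_⟩
  have e₁ : (L.envSheaf.presheaf.map (j ≫ i).op).hom s =
      L.toEnvSheaf W (EnvelopingAlgebra.map (L.res j.op) s') := by
    rw [← toEnvSheaf_res, ← e, op_comp, Functor.map_comp]; rfl
  have e₂ : (L.envSheaf.presheaf.map (j ≫ i).op).hom t = L.toEnvSheaf W t' := by
    rw [← e', op_comp, Functor.map_comp]; rfl
  rw [map_sub, map_mul, map_mul, map_sub, map_mul, map_mul, e₁, e₂]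

theorem gr_mul_comm (U : Opens X) (a b : (L.envFiltration U).Gr) : a * b = b * a :=
  RingFiltration.gr_mul_comm _ (L.commutator_mem_below) a b

/-- The map `O(U) → gr 𝒰(O, L)(U)` in degree `0`. -/
def grScalar (U : Opens X) : O.presheaf.obj (op U) →+* (L.envFiltration U).Gr where
  toFun a := (L.envFiltration U).symbol 0 (L.toEnvSheaf U (EnvelopingAlgebra.ιA K _ _ a))
    (L.toEnvSheaf_mem (EnvelopingAlgebra.ιA_mem a))
  map_one' := (RingFiltration.symbol_congr _ rfl (by rw [map_one, map_one]) _
    (L.envFiltration U).one_mem).trans rfl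
  map_zero' := RingFiltration.symbol_eq_zero _ _ (by rw [map_zero, map_zero]; exact zero_mem _)
  map_mul' a b := by
    rw [RingFiltration.symbol_mul]
    exact RingFiltration.symbol_congr _ rfl (by rw [map_mul, map_mul]) _ _
  map_add' a b := by
    rw [← RingFiltration.symbol_add]
    exact RingFiltration.symbol_congr _ rfl (by rw [map_add, map_add]) _ _

/-- The map `L(U) → gr 𝒰(O, L)(U)` in degree `1`. -/
def grVector (U : Opens X) : L.obj (op U) →+ (L.envFiltration U).Gr where
  toFun D := (L.envFiltration U).symbol 1 (L.toEnvSheaf U (EnvelopingAlgebra.ιL K _ _ D))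
    (L.toEnvSheaf_mem (EnvelopingAlgebra.ιL_mem D))
  map_zero' := RingFiltration.symbol_eq_zero _ _ (by rw [map_zero, map_zero]; exact zero_mem _)
  map_add' a b := by
    rw [← RingFiltration.symbol_add]
    exact RingFiltration.symbol_congr _ rfl (by rw [map_add, map_add]) _ _

/-- The canonical map `S(L(U)) → gr 𝒰(O, L)(U)`. -/
def symToGr (U : Opens X) :
    SymmetricAlgebra (O.presheaf.obj (op U)) (L.obj (op U)) →+* (L.envFiltration U).Gr :=
  SymmetricAlgebra.liftRing (L.gr_mul_comm U) (L.grScalar U) (L.grVector U) (fun a D => by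
    refine Eq.trans ?_ (RingFiltration.symbol_mul _ _ _).symm
    exact RingFiltration.symbol_congr _ (zero_add 1).symm
      (by rw [EnvelopingAlgebra.ιL_smul, map_mul]) _ _)

theorem symToGr_algebraMap (U : Opens X) (a : O.presheaf.obj (op U)) :
    L.symToGr U (algebraMap _ _ a) = L.grScalar U a :=
  SymmetricAlgebra.liftRing_algebraMap ..

theorem symToGr_ι (U : Opens X) (D : L.obj (op U)) :
    L.symToGr U (SymmetricAlgebra.ι _ _ D) = L.grVector U D :=
  SymmetricAlgebra.liftRing_ι ..

theorem monomial_mem (U : Opens X) (a : O.presheaf.obj (op U)) (l : List (L.obj (op U))) :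
    EnvelopingAlgebra.ιA K _ _ a * (l.map (EnvelopingAlgebra.ιL K (O.presheaf.obj (op U)) _)).prod ∈
      (L.sectionFiltration U).F l.length :=
  AddSubgroup.subset_closure ⟨a, l, le_rfl, rfl⟩

/-- Symbols multiply, so a product of degree-1 classes is the class of the product in `𝒰`. -/
theorem symToGr_monomial (U : Opens X) (a : O.presheaf.obj (op U)) (l : List (L.obj (op U))) :
    L.symToGr U (algebraMap _ _ a *
      (l.map (SymmetricAlgebra.ι (O.presheaf.obj (op U)) (L.obj (op U)))).prod) =
    (L.envFiltration U).symbol l.length (L.toEnvSheaf U (EnvelopingAlgebra.ιA K _ _ a *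
      (l.map (EnvelopingAlgebra.ιL K (O.presheaf.obj (op U)) _)).prod))
      (L.toEnvSheaf_mem (L.monomial_mem U a l)) := by
  have hprod : L.symToGr U
      ((l.map (SymmetricAlgebra.ι (O.presheaf.obj (op U)) (L.obj (op U)))).prod) =
      (L.envFiltration U).symbol l.length (L.toEnvSheaf U
        (l.map (EnvelopingAlgebra.ιL K (O.presheaf.obj (op U)) _)).prod)
        (L.toEnvSheaf_mem (EnvelopingAlgebra.prod_mem l)) := by
    induction l with
    | nil =>
      rw [List.map_nil, List.prod_nil, map_one]
      exact (RingFiltration.symbol_congr _ rfl (by simp) (L.envFiltration U).one_mem _)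
    | cons D l ih =>
      rw [List.map_cons, List.prod_cons, map_mul, ih, symToGr_ι]
      refine (RingFiltration.symbol_mul _ _ _).trans ?_
      exact RingFiltration.symbol_congr _ (by rw [List.length_cons, add_comm])
        (by rw [List.map_cons, List.prod_cons, map_mul]) _ _
  rw [map_mul, hprod, symToGr_algebraMap]
  refine (RingFiltration.symbol_mul _ _ _).trans ?_
  exact RingFiltration.symbol_congr _ (zero_add _) (by rw [map_mul]) _ _

theorem symToGr_res {U V : Opens X} (i : V ⟶ U)
    (p : SymmetricAlgebra (O.presheaf.obj (op U)) (L.obj (op U))) :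
    RingFiltration.grMap (L.isFiltered_res i) (L.symToGr U p) =
      L.symToGr V (L.symMap i.op p) := by
  suffices h : (RingFiltration.grMap (L.isFiltered_res i)).comp (L.symToGr U) =
      (L.symToGr V).comp (L.symMap i.op) from RingHom.congr_fun h p
  apply L.sym_hom_ext
  · intro a
    rw [RingHom.comp_apply, RingHom.comp_apply, symMap_algebraMap, symToGr_algebraMap,
      symToGr_algebraMap]
    refine (RingFiltration.grMap_symbol _ _).trans ?_
    exact RingFiltration.symbol_congr _ rfl
      (by rw [toEnvSheaf_res, EnvelopingAlgebra.map_ιA]) _ _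
  · intro D
    rw [RingHom.comp_apply, RingHom.comp_apply, symMap_ι, symToGr_ι, symToGr_ι]
    refine (RingFiltration.grMap_symbol _ _).trans ?_
    exact RingFiltration.symbol_congr _ rfl
      (by rw [toEnvSheaf_res, EnvelopingAlgebra.map_ιL]) _ _

/-- The morphism of presheaves `S(L(U)) → gr 𝒰(O, L)(U)`. -/
def symToGrPresheaf : L.symPresheaf ⟶ L.grPresheaf where
  app U := RingCat.ofHom (L.symToGr U.unop)
  naturality U V i := by
    ext1
    refine RingHom.ext fun p => ?_
    exact (L.symToGr_res i.unop p).symm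

/-! ### Local surjectivity -/

theorem exists_symToGr_eq_symbol {n : ℕ} {U : Opens X}
    {t : EnvelopingAlgebra K (O.presheaf.obj (op U)) (L.obj (op U))}
    (ht : t ∈ (L.sectionFiltration U).F n) :
    ∃ p, L.symToGr U p = (L.envFiltration U).symbol n (L.toEnvSheaf U t) (L.toEnvSheaf_mem ht) := by
  induction ht using AddSubgroup.closure_induction with
  | mem t ht =>
    obtain ⟨a, l, hl, rfl⟩ := ht
    rcases hl.eq_or_lt with rfl | hl
    · exact ⟨_, L.symToGr_monomial U a l⟩
    -- A product with fewer than `n` vectors lies in `F (n - 1)`, so its symbol of degree `n` is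
    -- zero.
    · refine ⟨0, ?_⟩
      rw [map_zero, RingFiltration.symbol_eq_zero]
      obtain ⟨n, rfl⟩ : ∃ k, n = k + 1 := ⟨n - 1, by omega⟩
      exact (L.envFiltration U).mono (by omega) (L.toEnvSheaf_mem (L.monomial_mem U a l))
  | zero =>
    refine ⟨0, ?_⟩
    rw [map_zero, RingFiltration.symbol_eq_zero]
    rw [map_zero]; exact zero_mem _
  | add t t' h h' ih ih' =>
    obtain ⟨p, hp⟩ := ih
    obtain ⟨q, hq⟩ := ih'
    refine ⟨p + q, ?_⟩
    rw [map_add, hp, hq, ← RingFiltration.symbol_add]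
    exact RingFiltration.symbol_congr _ rfl (map_add _ _ _).symm _ _
  | neg t h ih =>
    obtain ⟨p, hp⟩ := ih
    refine ⟨-p, ?_⟩
    rw [map_neg, neg_eq_iff_add_eq_zero, hp, ← RingFiltration.symbol_add,
      RingFiltration.symbol_eq_zero]
    rw [map_neg, add_neg_cancel]; exact zero_mem _

/-- An element of the direct sum is a finite sum of symbols, so the neighbourhoods needed for its
terms can be intersected. -/
theorem exists_symToGr_eq_res {U : Opens X} (g : (L.envFiltration U).Gr) {x : X} (hx : x ∈ U) :
    ∃ (V : Opens X) (_ : x ∈ V) (i : V ⟶ U) (p : _),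
      L.symToGr V p = RingFiltration.grMap (L.isFiltered_res i) g := by
  induction g using RingFiltration.gr_induction with
  | zero => exact ⟨U, hx, 𝟙 U, 0, by rw [map_zero, map_zero]⟩
  | symbol n s hs =>
    obtain ⟨V, hxV, i, t, ht, e⟩ := hs x hx
    obtain ⟨p, hp⟩ := L.exists_symToGr_eq_symbol ht
    refine ⟨V, hxV, i, p, ?_⟩
    rw [hp, RingFiltration.grMap_symbol]
    exact RingFiltration.symbol_congr _ rfl e.symm _ _
  | add g g' h h' =>
    obtain ⟨V, hxV, i, p, hp⟩ := h
    obtain ⟨V', hxV', i', p', hp'⟩ := h'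
    refine ⟨V ⊓ V', ⟨hxV, hxV'⟩, Opens.infLELeft V V' ≫ i,
      L.symMap (Opens.infLELeft V V').op p + L.symMap (Opens.infLERight V V').op p', ?_⟩
    rw [map_add, ← symToGr_res, ← symToGr_res, hp, hp', map_add]
    congr 1
    · exact (RingHom.congr_fun (congrArg RingCat.Hom.hom
        (L.grPresheaf.map_comp i.op (Opens.infLELeft V V').op)) g).symm
    · exact (RingHom.congr_fun (congrArg RingCat.Hom.hom
        (L.grPresheaf.map_comp i'.op (Opens.infLERight V V').op)) g').symm

instance : Presheaf.IsLocallySurjective (Opens.grothendieckTopology X) L.symToGrPresheaf where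
  imageSieve_mem {U} g := by
    intro x hx
    obtain ⟨V, hxV, i, p, hp⟩ := L.exists_symToGr_eq_res g hx
    exact ⟨V, i, ⟨p, hp⟩, hxV⟩

end LieAlgebroid

/-! ### Local injectivity -/

namespace LieAlgebroid

open LieRinehartAlgebra

variable {K : Type u} [Field K] {X : TopCat.{u}} {O : TopCat.Sheaf (CommAlgCat.{u} K) X}
  (L : LieAlgebroid O)

/-- The map from a presheaf to its sheafification is locally injective. -/
theorem exists_map_res_eq {U : Opens X}
    {t t' : EnvelopingAlgebra K (O.presheaf.obj (op U)) (L.obj (op U))}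
    (h : L.toEnvSheaf U t = L.toEnvSheaf U t') {x : X} (hx : x ∈ U) :
    ∃ (V : Opens X) (_ : x ∈ V) (i : V ⟶ U),
      EnvelopingAlgebra.map (L.res i.op) t = EnvelopingAlgebra.map (L.res i.op) t' := by
  obtain ⟨V, i, hi, hxV⟩ := Presheaf.equalizerSieve_mem (Opens.grothendieckTopology X)
    (toSheafify (Opens.grothendieckTopology X) L.envPresheaf) (X := op U) t t' h x hx
  exact ⟨V, hxV, i, hi⟩

variable {x : X}

theorem map_germ_map_res {V W : Nhd x} (h : V ≤ W)
    (t : EnvelopingAlgebra K (O.presheaf.obj (op V.opens)) (L.obj (op V.opens))) :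
    EnvelopingAlgebra.map (L.germ W) (EnvelopingAlgebra.map (L.res (Nhd.incl h).op) t) =
      EnvelopingAlgebra.map (L.germ V) t := by
  suffices e : (EnvelopingAlgebra.map (L.germ W)).comp
      (EnvelopingAlgebra.map (L.res (Nhd.incl h).op)) = EnvelopingAlgebra.map (L.germ V) from
    DFunLike.congr_fun e t
  apply EnvelopingAlgebra.hom_ext
  · intro a
    rw [AlgHom.comp_apply]
    simp only [EnvelopingAlgebra.map_ιA]
    exact congrArg _ (germO_res h a)
  · intro s
    rw [AlgHom.comp_apply]
    simp only [EnvelopingAlgebra.map_ιL]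
    exact congrArg _ (L.germ_res h s)

/-! ### Comparison with the PBW symbol over a stalk -/

section Basis

variable {L} {I : Type u} (b : Module.Basis I (StalkO O x) (L.Stalk x))

/-- The germ of a section of the symmetric algebra, as a polynomial over the stalk of `O`. -/
def symGerm (V : Nhd x) : SymmetricAlgebra (O.presheaf.obj (op V.opens)) (L.obj (op V.opens)) →+*
    MvPolynomial I (StalkO O x) :=
  SymmetricAlgebra.liftRing mul_comm (MvPolynomial.C.comp (germO V).toRingHom)
    ((linForm b).toAddMonoidHom.comp (L.germFun V).toAddMonoidHom) (fun a s => by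
      change linForm b (L.germFun V (a • s)) =
        MvPolynomial.C (germO V a) * linForm b (L.germFun V s)
      rw [← germO_smul, map_smul, MvPolynomial.C_mul'])

theorem symGerm_algebraMap (V : Nhd x) (a : O.presheaf.obj (op V.opens)) :
    symGerm b V (algebraMap _ _ a) = MvPolynomial.C (germO V a) :=
  SymmetricAlgebra.liftRing_algebraMap ..

theorem symGerm_ι (V : Nhd x) (s : L.obj (op V.opens)) :
    symGerm b V (SymmetricAlgebra.ι _ _ s) = linForm b (L.germ V s) :=
  SymmetricAlgebra.liftRing_ι ..

theorem symGerm_res {V W : Nhd x} (h : V ≤ W)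
    (p : SymmetricAlgebra (O.presheaf.obj (op V.opens)) (L.obj (op V.opens))) :
    symGerm b W (L.symMap (Nhd.incl h).op p) = symGerm b V p := by
  suffices e : (symGerm b W).comp (L.symMap (Nhd.incl h).op) = symGerm b V from
    RingHom.congr_fun e p
  apply L.sym_hom_ext
  · intro a
    rw [RingHom.comp_apply, symMap_algebraMap, symGerm_algebraMap, symGerm_algebraMap]
    exact congrArg _ (germO_res h a)
  · intro s
    rw [RingHom.comp_apply, symMap_ι, symGerm_ι, symGerm_ι, L.germ_res h s]

variable [LinearOrder I]

/-- Lower filtration degree in the sheaf is only a local statement, but near `x` the element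
coincides with one of the presheaf's lower filtration step, and both have the same germ. -/
theorem pbwSymbol_germ_eq_zero {V : Nhd x} {n : ℕ}
    {t : EnvelopingAlgebra K (O.presheaf.obj (op V.opens)) (L.obj (op V.opens))}
    (ht : L.toEnvSheaf V.opens t ∈ (L.envFiltration V.opens).below n) :
    pbwSymbol K b n (EnvelopingAlgebra.map (L.germ V) t) = 0 := by
  obtain ⟨W, hxW, i, t', ht', e⟩ := L.exists_below_of_mem_below ht V.mem
  rw [toEnvSheaf_res] at e
  obtain ⟨W', hxW', j, e'⟩ := L.exists_map_res_eq e hxW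
  have h : V ≤ Nhd.mk W hxW := i.le
  have h' : Nhd.mk W hxW ≤ Nhd.mk W' hxW' := j.le
  have e₁ : EnvelopingAlgebra.map (L.germ V) t =
      EnvelopingAlgebra.map (L.germ (Nhd.mk W hxW)) t' := by
    rw [← L.map_germ_map_res h, ← L.map_germ_map_res h', ← L.map_germ_map_res h' t']
    exact congrArg _ e'
  rw [e₁]
  cases n with
  | zero =>
    have h0 : t' = 0 := ht'
    rw [h0]
    exact (congrArg _ (map_zero (EnvelopingAlgebra.map (L.germ (Nhd.mk W hxW))))).trans
      (map_zero _)
  | succ n =>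
    exact pbwSymbol_eq_zero b (Nat.lt_succ_self n) (EnvelopingAlgebra.map_mem _ ht')

/-- The `t n` lift the graded components of `symToGr p` to `𝒰` while their PBW symbols are the
homogeneous components of the germ of `p`. This links the two sides without defining a map from the
graded ring to polynomials. -/
theorem exists_components (V : Nhd x)
    (p : SymmetricAlgebra (O.presheaf.obj (op V.opens)) (L.obj (op V.opens))) :
    ∃ t : ℕ → EnvelopingAlgebra K (O.presheaf.obj (op V.opens)) (L.obj (op V.opens)),
      ∃ ht : ∀ n, t n ∈ (L.sectionFiltration V.opens).F n,
      (∀ n, (L.symToGr V.opens p) n = (L.envFiltration V.opens).piece n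
        (L.toEnvSheaf V.opens (t n)) (L.toEnvSheaf_mem (ht n))) ∧
      ∀ n, MvPolynomial.homogeneousComponent n (symGerm b V p) =
        pbwSymbol K b n (EnvelopingAlgebra.map (L.germ V) (t n)) := by
  have hp := AddSubgroup.mem_top p
  rw [← SymmetricAlgebra.closure_products_eq_top] at hp
  induction hp using AddSubgroup.closure_induction with
  | zero =>
    refine ⟨0, fun _ => zero_mem _, fun n => ?_, fun n => ?_⟩
    · rw [map_zero]
      refine Eq.symm ((RingFiltration.piece_eq_zero_iff _ _).2 ?_)
      rw [Pi.zero_apply, map_zero]; exact zero_mem _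
    · rw [Pi.zero_apply, map_zero, map_zero, map_zero, map_zero]
  | add p q _ _ hp hq =>
    obtain ⟨t, ht, h1, h2⟩ := hp
    obtain ⟨t', ht', h1', h2'⟩ := hq
    refine ⟨t + t', fun n => add_mem (ht n) (ht' n), fun n => ?_, fun n => ?_⟩
    · rw [map_add, DirectSum.add_apply, h1, h1', RingFiltration.piece_add]
      congr 1
      rw [Pi.add_apply, map_add]
    · rw [Pi.add_apply, map_add, map_add, map_add, map_add, h2, h2']
  | neg p _ hp =>
    obtain ⟨t, ht, h1, h2⟩ := hp
    refine ⟨-t, fun n => neg_mem (ht n), fun n => ?_, fun n => ?_⟩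
    · rw [map_neg]
      change -((L.symToGr V.opens p) n) = _
      rw [h1, neg_eq_iff_add_eq_zero, RingFiltration.piece_add, RingFiltration.piece_eq_zero_iff]
      rw [Pi.neg_apply, map_neg, add_neg_cancel]; exact zero_mem _
    · rw [Pi.neg_apply, map_neg, map_neg, map_neg, map_neg, h2]
  | mem p hp =>
    obtain ⟨a, l, rfl⟩ := hp
    have hS : symGerm b V (algebraMap _ _ a * (l.map (SymmetricAlgebra.ι _ _)).prod) =
        MvPolynomial.C (germO V a) * ((l.map (L.germ V)).map (linForm b)).prod := by
      rw [map_mul, symGerm_algebraMap, map_list_prod, List.map_map, List.map_map]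
      congr 3
      funext s
      exact symGerm_ι b V s
    have hU : EnvelopingAlgebra.map (L.germ V) (EnvelopingAlgebra.ιA K _ _ a *
        (l.map (EnvelopingAlgebra.ιL K (O.presheaf.obj (op V.opens)) _)).prod) =
        EnvelopingAlgebra.ιA K _ _ (germO V a) * ((l.map (L.germ V)).map
          (EnvelopingAlgebra.ιL K (StalkO O x) (L.Stalk x))).prod := by
      rw [map_mul, EnvelopingAlgebra.map_ιA, map_list_prod, List.map_map, List.map_map]
      congr 3
      funext s
      exact EnvelopingAlgebra.map_ιL _ s
    have hsym := pbwSymbol_ιA_mul_prod (K := K) b (germO V a) (l.map (L.germ V))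
    rw [← hU, ← hS, List.length_map] at hsym
    -- By `hsym` this polynomial is itself a homogeneous component of degree `l.length`.
    have hom : MvPolynomial.homogeneousComponent l.length (symGerm b V (algebraMap _ _ a *
        (l.map (SymmetricAlgebra.ι _ _)).prod)) = symGerm b V (algebraMap _ _ a *
        (l.map (SymmetricAlgebra.ι _ _)).prod) := by
      rw [← hsym]
      exact MvPolynomial.homogeneousComponent_eq_self
        (MvPolynomial.homogeneousComponent_isHomogeneous _ _)
    -- A product of `l.length` vectors has a single graded component, lifted by the same product in
    -- `𝒰`.
    refine ⟨Pi.single l.length (EnvelopingAlgebra.ιA K _ _ a *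
      (l.map (EnvelopingAlgebra.ιL K (O.presheaf.obj (op V.opens)) _)).prod),
      fun n => ?_, fun n => ?_, fun n => ?_⟩
    · by_cases h : n = l.length
      · subst h
        rw [Pi.single_eq_same]; exact L.monomial_mem _ a l
      · rw [Pi.single_eq_of_ne h]; exact zero_mem _
    · rw [symToGr_monomial]
      by_cases h : n = l.length
      · subst h
        refine (DirectSum.of_eq_same _ _).trans ?_
        congr 1
        rw [Pi.single_eq_same]
      · refine (DirectSum.of_eq_of_ne _ _ _ h).trans ?_
        refine Eq.symm ((RingFiltration.piece_eq_zero_iff _ _).2 ?_)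
        rw [Pi.single_eq_of_ne h, map_zero]; exact zero_mem _
    · by_cases h : n = l.length
      · subst h
        rw [Pi.single_eq_same, hsym, hom]
      · rw [Pi.single_eq_of_ne h, map_zero, map_zero, ← hom,
          MvPolynomial.homogeneousComponent_of_mem
            (MvPolynomial.homogeneousComponent_isHomogeneous _ _), if_neg h]

/-- Each lifted component lies in the lower filtration step, so its PBW symbol vanishes; hence every
homogeneous component of the germ does. -/
theorem symGerm_eq_zero {V : Nhd x}
    {p : SymmetricAlgebra (O.presheaf.obj (op V.opens)) (L.obj (op V.opens))}
    (hp : L.symToGr V.opens p = 0) : symGerm b V p = 0 := by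
  obtain ⟨t, ht, h1, h2⟩ := exists_components b V p
  rw [← MvPolynomial.sum_homogeneousComponent (symGerm b V p)]
  refine Finset.sum_eq_zero fun n _ => ?_
  rw [h2]
  apply pbwSymbol_germ_eq_zero
  rw [← RingFiltration.piece_eq_zero_iff _ (L.toEnvSheaf_mem (ht n)), ← h1, hp]
  rfl

end Basis

/-! ### Symmetric algebras near a point with a local basis -/

section LocalBasis

variable {L} {I : Type u} {V : Nhd x} (e : I → L.obj (op V.opens))

/-- The polynomials in the sections `e` as sections of the symmetric algebra. -/
def polyToSym {W : Nhd x} (h : V ≤ W) : MvPolynomial I (O.presheaf.obj (op W.opens)) →ₐ[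
    O.presheaf.obj (op W.opens)] SymmetricAlgebra (O.presheaf.obj (op W.opens))
      (L.obj (op W.opens)) :=
  MvPolynomial.aeval fun k => SymmetricAlgebra.ι _ _ (L.res (Nhd.incl h).op (e k))

theorem symMap_polyToSym {W W' : Nhd x} (h : V ≤ W) (h' : W ≤ W')
    (q : MvPolynomial I (O.presheaf.obj (op W.opens))) :
    L.symMap (Nhd.incl h').op (polyToSym e h q) =
      polyToSym e (h.trans h') (MvPolynomial.map (resO O W W' h').toRingHom q) := by
  suffices H : (L.symMap (Nhd.incl h').op).comp (polyToSym e h).toRingHom =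
      (polyToSym e (h.trans h')).toRingHom.comp
        (MvPolynomial.map (resO O W W' h').toRingHom) from RingHom.congr_fun H q
  apply MvPolynomial.ringHom_ext
  · intro a
    simp only [RingHom.comp_apply, MvPolynomial.map_C]
    change L.symMap _ (polyToSym e h (MvPolynomial.C a)) =
      polyToSym e (h.trans h') (MvPolynomial.C (resO O W W' h' a))
    rw [polyToSym, polyToSym, MvPolynomial.aeval_C, MvPolynomial.aeval_C]
    exact L.symMap_algebraMap _ a
  · intro k
    simp only [RingHom.comp_apply, MvPolynomial.map_X]
    change L.symMap _ (polyToSym e h (MvPolynomial.X k)) =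
      polyToSym e (h.trans h') (MvPolynomial.X k)
    rw [polyToSym, polyToSym, MvPolynomial.aeval_X, MvPolynomial.aeval_X, symMap_ι]
    exact congrArg _ (L.res_comp (Nhd.incl h).op (Nhd.incl h').op (e k)).symm

variable {e}

/-- On polynomials in the basis sections, taking the germ only changes coefficients, so vanishing
can be tested coefficientwise. -/
theorem IsLocalBasis.symGerm_polyToSym (he : L.IsLocalBasis e) {W : Nhd x} (h : V ≤ W)
    (q : MvPolynomial I (O.presheaf.obj (op W.opens))) :
    symGerm he.stalkBasis W (polyToSym e h q) = MvPolynomial.map (germO W).toRingHom q := by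
  suffices H : (symGerm he.stalkBasis W).comp (polyToSym e h).toRingHom =
      MvPolynomial.map (germO W).toRingHom from RingHom.congr_fun H q
  apply MvPolynomial.ringHom_ext
  · intro a
    simp only [RingHom.comp_apply, MvPolynomial.map_C]
    change symGerm _ W (polyToSym e h (MvPolynomial.C a)) = _
    rw [polyToSym, MvPolynomial.aeval_C]
    exact symGerm_algebraMap _ W a
  · intro k
    simp only [RingHom.comp_apply, MvPolynomial.map_X]
    change symGerm _ W (polyToSym e h (MvPolynomial.X k)) = _
    rw [polyToSym, MvPolynomial.aeval_X, symGerm_ι, L.germ_res h, ← he.stalkBasis_apply,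
      linForm_basis]

theorem symMap_comp {U V W : Nhd x} (h : U ≤ V) (h' : V ≤ W)
    (p : SymmetricAlgebra (O.presheaf.obj (op U.opens)) (L.obj (op U.opens))) :
    L.symMap (Nhd.incl (h.trans h')).op p =
      L.symMap (Nhd.incl h').op (L.symMap (Nhd.incl h).op p) :=
  RingHom.congr_fun (congrArg RingCat.Hom.hom
    (L.symPresheaf.map_comp (Nhd.incl h).op (Nhd.incl h').op)) p

/-- An element of the symmetric algebra involves finitely many sections of `L`, each a finite
combination of basis sections after shrinking. Shrinking is unavoidable in general, since these
sections span only locally. -/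
theorem IsLocalBasis.exists_polyToSym (he : L.IsLocalBasis e) {W : Nhd x} (h : V ≤ W)
    (p : SymmetricAlgebra (O.presheaf.obj (op W.opens)) (L.obj (op W.opens))) :
    ∃ (W' : Nhd x) (h' : W ≤ W') (q : _),
      L.symMap (Nhd.incl h').op p = polyToSym e (h.trans h') q := by
  induction p using SymmetricAlgebra.induction with
  | algebraMap a =>
    refine ⟨W, le_rfl, MvPolynomial.C (resO O W W le_rfl a), ?_⟩
    rw [symMap_algebraMap, polyToSym, MvPolynomial.aeval_C]
    rfl
  | ι s =>
    obtain ⟨W', hx, j, hs⟩ := (he W.opens (Nhd.incl h)).2 s x W.mem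
    have h' : W ≤ Nhd.mk W' hx := j.le
    refine ⟨Nhd.mk W' hx, h', ?_⟩
    rw [symMap_ι]
    have key : ∀ r ∈ Submodule.span (O.presheaf.obj (op (Nhd.mk W' hx).opens))
        (Set.range fun k => L.res (Nhd.incl (h.trans h')).op (e k)),
        ∃ q, SymmetricAlgebra.ι _ _ r = polyToSym e (h.trans h') q := by
      intro r hr
      induction hr using Submodule.span_induction with
      | mem r hr =>
        obtain ⟨k, rfl⟩ := hr
        exact ⟨MvPolynomial.X k, by rw [polyToSym, MvPolynomial.aeval_X]⟩
      | zero => exact ⟨0, by rw [map_zero, map_zero]⟩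
      | add r r' _ _ hr hr' =>
        obtain ⟨q, hq⟩ := hr
        obtain ⟨q', hq'⟩ := hr'
        exact ⟨q + q', by rw [map_add, map_add, hq, hq']⟩
      | smul a r _ hr =>
        obtain ⟨q, hq⟩ := hr
        exact ⟨a • q, by rw [map_smul, map_smul, hq]⟩
    exact key _ hs
  | mul p p' hp hp' =>
    obtain ⟨W₁, h₁, q, hq⟩ := hp
    obtain ⟨W₂, h₂, q', hq'⟩ := hp'
    obtain ⟨W', h₃, h₄⟩ := exists_ge_ge W₁ W₂
    refine ⟨W', h₁.trans h₃, MvPolynomial.map (resO O W₁ W' h₃).toRingHom q *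
      MvPolynomial.map (resO O W₂ W' h₄).toRingHom q', ?_⟩
    rw [map_mul, map_mul, symMap_comp h₁ h₃, hq, symMap_polyToSym]
    congr 1
    exact (symMap_comp h₂ h₄ p').trans (by rw [hq', symMap_polyToSym])
  | add p p' hp hp' =>
    obtain ⟨W₁, h₁, q, hq⟩ := hp
    obtain ⟨W₂, h₂, q', hq'⟩ := hp'
    obtain ⟨W', h₃, h₄⟩ := exists_ge_ge W₁ W₂
    refine ⟨W', h₁.trans h₃, MvPolynomial.map (resO O W₁ W' h₃).toRingHom q +
      MvPolynomial.map (resO O W₂ W' h₄).toRingHom q', ?_⟩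
    rw [map_add, map_add, symMap_comp h₁ h₃, hq, symMap_polyToSym]
    congr 1
    exact (symMap_comp h₂ h₄ p').trans (by rw [hq', symMap_polyToSym])

theorem exists_resO_eq_zero {W : Nhd x} {κ : Type u} (f : κ → O.presheaf.obj (op W.opens))
    (s : Finset κ) (hf : ∀ d ∈ s, germO W (f d) = 0) :
    ∃ (W' : Nhd x) (h : W ≤ W'), ∀ d ∈ s, resO O W W' h (f d) = 0 := by
  classical
  induction s using Finset.induction_on with
  | empty => exact ⟨W, le_rfl, by simp⟩
  | insert d s _ ih =>
    obtain ⟨W₁, h₁, e₁⟩ := ih fun d hd => hf d (Finset.mem_insert_of_mem hd)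
    obtain ⟨W₂, h₂, e₂⟩ := germO_eq (s := f d) (t := 0)
      ((hf d (Finset.mem_insert_self d s)).trans (map_zero _).symm)
    obtain ⟨W', h₃, h₄⟩ := exists_ge_ge W₁ W₂
    have comp : ∀ {W₁ : Nhd x} (h₁ : W ≤ W₁) (h₃ : W₁ ≤ W') (a : O.presheaf.obj (op W.opens)),
        resO O W₁ W' h₃ (resO O W W₁ h₁ a) = resO O W W' (h₁.trans h₃) a :=
      fun h₁ h₃ a => DirectedSystem.map_map' (resO O) h₁ h₃ a
    refine ⟨W', h₁.trans h₃, fun c hc => ?_⟩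
    rcases Finset.mem_insert.1 hc with rfl | hc
    · rw [← comp h₂ h₄, e₂, map_zero, map_zero]
    · rw [← comp h₁ h₃, e₁ c hc, map_zero]

theorem IsLocalBasis.exists_symMap_eq_zero (he : L.IsLocalBasis e) {W : Nhd x} (h : V ≤ W)
    {p : SymmetricAlgebra (O.presheaf.obj (op W.opens)) (L.obj (op W.opens))}
    (hp : symGerm he.stalkBasis W p = 0) :
    ∃ (W' : Nhd x) (h' : W ≤ W'), L.symMap (Nhd.incl h').op p = 0 := by
  obtain ⟨W₁, h₁, q, hq⟩ := he.exists_polyToSym h p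
  have hz : MvPolynomial.map (germO W₁).toRingHom q = 0 := by
    rw [← he.symGerm_polyToSym (h.trans h₁), ← hq, symGerm_res, hp]
  -- The support of `q` is finite, so one further shrinking kills all coefficients at once.
  obtain ⟨W₂, h₂, e₂⟩ := exists_resO_eq_zero (fun d => q.coeff d) q.support fun d _ => by
    have := congrArg (MvPolynomial.coeff d) hz
    rwa [MvPolynomial.coeff_map, MvPolynomial.coeff_zero] at this
  refine ⟨W₂, h₁.trans h₂, ?_⟩
  have hq0 : MvPolynomial.map (resO O W₁ W₂ h₂).toRingHom q = 0 := by
    ext d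
    rw [MvPolynomial.coeff_map, MvPolynomial.coeff_zero]
    by_cases hd : d ∈ q.support
    · exact e₂ d hd
    · rw [MvPolynomial.notMem_support_iff.1 hd, map_zero]
  rw [symMap_comp h₁ h₂, hq, symMap_polyToSym, hq0, map_zero]

end LocalBasis

variable {L}

theorem IsLocallyFree.exists_symMap_eq (hL : L.IsLocallyFree) {U : Opens X} (hx : x ∈ U)
    {p q : SymmetricAlgebra (O.presheaf.obj (op U)) (L.obj (op U))}
    (hpq : L.symToGr U p = L.symToGr U q) :
    ∃ (V : Opens X) (_ : x ∈ V) (i : V ⟶ U), L.symMap i.op p = L.symMap i.op q := by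
  obtain ⟨V, hxV, I, e, he⟩ := hL x
  have he : L.IsLocalBasis (U := (Nhd.mk V hxV).opens) e := he
  -- Any linear order on the index set will do: the recursion only takes minima of finite supports.
  let _ : LinearOrder I := IsWellOrder.linearOrder WellOrderingRel
  obtain ⟨W, hU, hV⟩ := exists_ge_ge (Nhd.mk U hx) (Nhd.mk V hxV)
  have h0 : L.symToGr W.opens (L.symMap (Nhd.incl hU).op (p - q)) = 0 := by
    refine (L.symToGr_res (Nhd.incl hU) (p - q)).symm.trans ((congrArg _ ?_).trans (map_zero _))
    exact (map_sub (L.symToGr U) p q).trans (sub_eq_zero.2 hpq)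
  obtain ⟨W', h', e'⟩ := he.exists_symMap_eq_zero hV (symGerm_eq_zero he.stalkBasis h0)
  refine ⟨W'.opens, W'.mem, Nhd.incl h' ≫ Nhd.incl hU, ?_⟩
  refine sub_eq_zero.1 ((map_sub _ p q).symm.trans ?_)
  exact (symMap_comp hU h' (p - q)).trans e'

theorem IsLocallyFree.isLocallyInjective (hL : L.IsLocallyFree) :
    Presheaf.IsLocallyInjective (Opens.grothendieckTopology X) L.symToGrPresheaf where
  equalizerSieve_mem p q h := by
    intro x hx
    obtain ⟨V, hxV, i, e⟩ := hL.exists_symMap_eq hx (p := p) (q := q) h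
    exact ⟨V, i, e, hxV⟩

end LieAlgebroid

end

/-! ### The isomorphism of sheaves -/

theorem mainTheorem1 {K : Type u} [Field K] [CharZero K] {X : TopCat.{u}}
    (O : TopCat.Sheaf (CommAlgCat.{u} K) X) (L : LieAlgebroid O) (hL : L.IsLocallyFree) :
    ∃ θ : L.symSheaf ≅ L.grSheaf,
      (∀ (U : Opens X) (f : O.presheaf.obj (op U)),
        (θ.hom.hom.app (op U)).hom (L.symStr U f) = L.grStr U f) ∧
      (∀ (U : Opens X) (D : L.obj (op U)),
        (θ.hom.hom.app (op U)).hom (L.symι U D) = L.grι U D) := by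
  have hinj := hL.isLocallyInjective
  have hW : (Opens.grothendieckTopology X).W L.symToGrPresheaf :=
    GrothendieckTopology.W_of_isLocallyBijective _ _
  have hiso : IsIso ((presheafToSheaf (Opens.grothendieckTopology X) RingCat.{u}).map
      L.symToGrPresheaf) := (GrothendieckTopology.W_iff _ _).1 hW
  -- Naturality of the unit of sheafification: on sections coming from the presheaf, the isomorphism
  -- is computed by `symToGr`.
  have key : ∀ (U : Opens X) (p : SymmetricAlgebra (O.presheaf.obj (op U)) (L.obj (op U))),
      (((presheafToSheaf (Opens.grothendieckTopology X) RingCat.{u}).map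
        L.symToGrPresheaf).hom.app (op U)).hom
        (((toSheafify (Opens.grothendieckTopology X) L.symPresheaf).app (op U)).hom p) =
      ((toSheafify (Opens.grothendieckTopology X) L.grPresheaf).app (op U)).hom
        (L.symToGr U p) := fun U p =>
    (congrArg (fun f => (f.app (op U)).hom p) (toSheafify_naturality
      (Opens.grothendieckTopology X) L.symToGrPresheaf)).symm
  refine ⟨@asIso _ _ _ _ _ hiso, fun U f => ?_, fun U D => ?_⟩
  · refine (key U _).trans ?_
    rw [LieAlgebroid.symToGr_algebraMap]
    rfl
  · refine (key U _).trans ?_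
    rw [LieAlgebroid.symToGr_ι]
    rfl
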